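/- Let $N\ge 0$, let $V:\mathbb{R}^N\to\mathbb{R}$ be $C^\infty$, and let $\nu=e^{-V}$. Let $\mu_0$ be a probability density on $\mathbb{R}^N$, and let $\mu_{t|0}(x\,|\,x_0)$, $t>0$, be a transition density of the Fokker--Planck flow with potential $V$: it is positive and $C^\infty$ in $(t,x_0,x)\in(0,\infty)\times\mathbb{R}^N\times\mathbb{R}^N$, each $\mu_{t|0}(\cdot\,|\,x_0)$ is a probability density that solves $$\partial_t\mu=\Delta\mu+\nabla\cdot(\mu\nabla V)\quad\text{on }(0,\infty)\times\mathbb{R}^N,$$ and $\mu_{t|0}(x\,|\,x_0)\,dx\to\delta_{x_0}$ weakly as $t\downarrow0$. Let $X_0\sim\mu_0$ and let $X_t$ have conditional density $\mu_{t|0}(\cdot\,|\,x_0)$ given $X_0=x_0$. Write $\mu_{0,t}(x_0,x)=\mu_0(x_0)\mu_{t|0}(x|x_0)$ for the joint density of $(X_0,X_t)$, $\mu_t(x)=\int\mu_{0,t}(x_0,x)\,dx_0$ for the density of $X_t$, $\mu_{0|t}=\mu_{0,t}/\mu_t$ for the density of $X_0$ given $X_t=x$, and $\gamma_t=e^{V/2}\mu_t$.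 Assume that the solution is rapidly decreasing in the following sense: for all $0<a\le b$ and all integers $k,m\ge0$, $$\sup_{t\in[a,b],\;x_0,x\in\mathbb{R}^N}\ \mu_{0,t}(x_0,x)\,\Big(\|x_0\|+\|x\|+\|\nabla_x^kV(x)\|+\|\nabla_x^k\log\mu_{t|0}(x|x_0)\|\Big)^m<\infty .$$ For a density $f$ let $H(f)=-\int f\log f$ and $J_\nu(f)=\int f\,\|\nabla\log\frac f\nu\|^2$, and put $$I(X_0;X_t)=H(\mu_t)-\int\mu_0(x_0)H(\mu_{t|0}(\cdot|x_0))\,dx_0,$$ $$J_\nu(\mu_0;\mu_t)=\int\mu_0(x_0)J_\nu(\mu_{t|0}(\cdot|x_0))\,dx_0-J_\nu(\mu_t),$$ $$\Psi(\mu_0|\mu_t)=\int_{\mathbb{R}^{2N}}\mu_{0,t}\,\|\nabla^2\log\mu_{0|t}\|_{HS}^2\,dx_0\,dx ,$$ where here and below all gradients and Hessians are taken in the variable $x$ of $X_t$, and $\langle A,B\rangle_{HS}=\sum_{i,j}A_{ij}B_{ij}$. Then for every $t>0$ all the integrals above and below converge absolutely, $s\mapsto I(X_0;X_s)$ is twice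 differentiable at $t$, and $$\frac{d}{dt}I(X_0;X_t)=-J_\nu(\mu_0;\mu_t)\le0,$$ $$\frac{d^2}{dt^2}I(X_0;X_t)=2\Psi(\mu_0|\mu_t)+4\int_{\mathbb{R}^{2N}}\mu_{0,t}\,\langle\nabla^2\log\gamma_t,\nabla^2\log\mu_{0|t}\rangle_{HS}\,dx_0\,dx$$ $$\qquad=2\Psi(\mu_0|\mu_t)-4\int_{\mathbb{R}^{2N}}\mu_{0,t}\,(\nabla\log\mu_{0|t})^{\top}(\nabla^2\log\gamma_t)(\nabla\log\mu_{0|t})\,dx_0\,dx .$$ -/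

import Mathlib

open MeasureTheory Filter Topology Set
open scoped ContDiff BoundedContinuousFunction Gradient Matrix

noncomputable section

namespace FPFlow

/-- Euclidean space `ℝ^N`. -/
abbrev E (N : ℕ) := EuclideanSpace ℝ (Fin N)

variable {N : ℕ}

/-! ### Differential operators -/

/-- The divergence `∑ᵢ ∂ᵢ Fᵢ` of a vector field. -/
def divergence (F : E N → E N) (x : E N) : ℝ :=
  ∑ i, (fderiv ℝ F x (EuclideanSpace.single i 1)) i

/-- The Hessian matrix `(∂ᵢ ∂ⱼ f)ᵢⱼ`. -/
def hessian (f : E N → ℝ) (x : E N) : Matrix (Fin N) (Fin N) ℝ :=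
  Matrix.of fun i j =>
    fderiv ℝ (fun y => fderiv ℝ f y (EuclideanSpace.single j 1)) x (EuclideanSpace.single i 1)

/-- The Hilbert-Schmidt inner product of two matrices. -/
def hsInner (A B : Matrix (Fin N) (Fin N) ℝ) : ℝ := ∑ i, ∑ j, A i j * B i j

/-! ### Information functionals of probability densities -/

/-- `f` is a probability density on `ℝ^N`. -/
structure IsProbDensity (f : E N → ℝ) : Prop where
  measurable : Measurable f
  nonneg : ∀ x, 0 ≤ f x
  integral_eq_one : ∫ x, f x = 1

/-- The density `e^{-V}` of the reference measure. -/
def refDensity (V : E N → ℝ) (x : E N) : ℝ := Real.exp (-V x)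

/-- The integrand of the negative entropy. -/
def entropyIntegrand (f : E N → ℝ) (x : E N) : ℝ := f x * Real.log (f x)

/-- The differential entropy `H(f) = - ∫ f log f`. -/
def entropy (f : E N → ℝ) : ℝ := -∫ x, entropyIntegrand f x

/-- The integrand `f ‖∇ log (f / ν)‖²` of the relative Fisher information. -/
def relFisherIntegrand (V f : E N → ℝ) (x : E N) : ℝ :=
  f x * ‖∇ (fun y => Real.log (f y / refDensity V y)) x‖ ^ 2

/-- The relative Fisher information `J_ν(f) = ∫ f ‖∇ log (f / ν)‖²`, where `ν = e^{-V}`. -/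
def relFisher (V f : E N → ℝ) : ℝ := ∫ x, relFisherIntegrand V f x

/-! ### Joint laws

A pair `(X, Y)` is described by the density `ρ` of `X` and the conditional densities
`k x = k x ·` of `Y` given `X = x`. -/

/-- The density of `Y`. -/
def marginal (ρ : E N → ℝ) (k : E N → E N → ℝ) (y : E N) : ℝ := ∫ x, ρ x * k x y

/-- The joint density of `(X, Y)`. -/
def joint (ρ : E N → ℝ) (k : E N → E N → ℝ) (x y : E N) : ℝ := ρ x * k x y

/-- The density at `x` of `X` given `Y = y`. -/
def posterior (ρ : E N → ℝ) (k : E N → E N → ℝ) (x y : E N) : ℝ :=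
  joint ρ k x y / marginal ρ k y

/-- The conditional version `F(Y|X) = ∫ ρ(x) F(k x) dx` of a functional `F`. -/
def condVersion (F : (E N → ℝ) → ℝ) (ρ : E N → ℝ) (k : E N → E N → ℝ) : ℝ :=
  ∫ x, ρ x * F (k x)

/-- The mutual information `I(X;Y) = H(Y) - H(Y|X)`. -/
def mutualInfo (ρ : E N → ℝ) (k : E N → E N → ℝ) : ℝ :=
  entropy (marginal ρ k) - condVersion entropy ρ k

/-- The mutual relative Fisher information `J_ν(X;Y) = J_ν(Y|X) - J_ν(Y)`. -/
def mutualRelFisher (V ρ : E N → ℝ) (k : E N → E N → ℝ) : ℝ :=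
  condVersion (relFisher V) ρ k - relFisher V (marginal ρ k)

/-- The gradient in `y` of the logarithm of the density of `X` given `Y = y`. -/
def gradLogPosterior (ρ : E N → ℝ) (k : E N → E N → ℝ) (x y : E N) : E N :=
  ∇ (fun y' => Real.log (posterior ρ k x y')) y

/-- The Hessian in `y` of the logarithm of the density of `X` given `Y = y`. -/
def hessLogPosterior (ρ : E N → ℝ) (k : E N → E N → ℝ) (x y : E N) :
    Matrix (Fin N) (Fin N) ℝ :=
  hessian (fun y' => Real.log (posterior ρ k x y')) y

/-- The integrand of the backward second-order Fisher information. -/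
def backwardFisherTwoIntegrand (ρ : E N → ℝ) (k : E N → E N → ℝ) (z : E N × E N) : ℝ :=
  joint ρ k z.1 z.2 *
    hsInner (hessLogPosterior ρ k z.1 z.2) (hessLogPosterior ρ k z.1 z.2)

/-- The backward second-order Fisher information
`Ψ(X|Y) = ∫∫ μ_{XY} ‖∇²_y log μ_{X|Y}‖²_HS dx dy`. -/
def backwardFisherTwo (ρ : E N → ℝ) (k : E N → E N → ℝ) : ℝ :=
  ∫ z, backwardFisherTwoIntegrand ρ k z

/-- The logarithm of `γ = e^{V/2} μ_Y`. -/
def logGamma (V ρ : E N → ℝ) (k : E N → E N → ℝ) (y : E N) : ℝ :=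
  Real.log (Real.exp (V y / 2) * marginal ρ k y)

/-- `μ_{XY} ⟨∇² log γ, ∇² log μ_{X|Y}⟩_HS`, with derivatives in `y`. -/
def crossHessIntegrand (V ρ : E N → ℝ) (k : E N → E N → ℝ) (z : E N × E N) : ℝ :=
  joint ρ k z.1 z.2 *
    hsInner (hessian (logGamma V ρ k) z.2) (hessLogPosterior ρ k z.1 z.2)

/-- `μ_{XY} (∇ log μ_{X|Y})ᵀ (∇² log γ) (∇ log μ_{X|Y})`, with derivatives in `y`. -/
def quadFormIntegrand (V ρ : E N → ℝ) (k : E N → E N → ℝ) (z : E N × E N) : ℝ :=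
  joint ρ k z.1 z.2 *
    ((gradLogPosterior ρ k z.1 z.2).ofLp ⬝ᵥ
      (hessian (logGamma V ρ k) z.2 *ᵥ (gradLogPosterior ρ k z.1 z.2).ofLp))

/-! ### The Fokker-Planck flow -/

/-- `p t x₀ x` is a smooth positive transition density (of `X_t` at `x` given `X_0 = x₀`) of the
Fokker-Planck flow with potential `V`: for every `x₀` it is a classical solution of
`∂ₜ p = Δ p + ∇ · (p ∇V)` on `(0, ∞) × ℝ^N`, it consists of probability densities, and it
starts from the point mass at `x₀`. -/
structure IsTransitionDensity (V : E N → ℝ) (p : ℝ → E N → E N → ℝ) : Prop where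
  smooth : ContDiffOn ℝ ∞ (fun q : ℝ × E N × E N => p q.1 q.2.1 q.2.2) (Ioi 0 ×ˢ univ)
  pos : ∀ t, 0 < t → ∀ x₀ x, 0 < p t x₀ x
  prob : ∀ t, 0 < t → ∀ x₀, IsProbDensity (p t x₀)
  fokkerPlanck : ∀ t, 0 < t → ∀ x₀ x,
    HasDerivAt (fun s => p s x₀ x)
      (Laplacian.laplacian (p t x₀) x + divergence (fun y => p t x₀ y • ∇ V y) x) t
  initial : ∀ x₀, ∀ φ : E N →ᵇ ℝ,
    Tendsto (fun t => ∫ x, φ x * p t x₀ x) (𝓝[>] 0) (𝓝 (φ x₀))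

/-- The solution decreases rapidly: locally uniformly in `t > 0`, the joint density
`μ₀(x₀) p_t(x₀, x)` decreases faster than any power of `‖x₀‖`, of `‖x‖` and of the sizes of
`V(x)`, `log p_t(x₀, x)` and their derivatives in `x`. -/
def RapidlyDecreasing (V μ₀ : E N → ℝ) (p : ℝ → E N → E N → ℝ) : Prop :=
  ∀ a b : ℝ, 0 < a → ∀ k m : ℕ, ∃ C : ℝ, ∀ t ∈ Icc a b, ∀ x₀ x : E N,
    joint μ₀ (p t) x₀ x *
      (‖x₀‖ + ‖x‖ + ‖iteratedFDeriv ℝ k V x‖ +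
        ‖iteratedFDeriv ℝ k (fun y => Real.log (p t x₀ y)) x‖) ^ m ≤ C

end FPFlow

end

/-! Write `φ = log (q/ν)` for a solution `q` of the Fokker-Planck equation, which then reads `∂ₜ q =
∇·(q ∇φ)`. Two classical computations drive the proof: relative entropy is dissipated at the rate of
the relative Fisher information, `d/dt ∫ q φ = -∫ q |∇φ|²`, and by Bochner's identity `d/dt ∫ q
|∇φ|² = -2 ∫ q (|∇²φ|² + ∇φᵀ ∇²V ∇φ)`. Both apply to the joint density, with the starting point as a
parameter, and to the marginal `μₜ`. The structure `LogFPSystem` records what the computations use,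
so that they are done once (`hasDerivAt_relEntropy`, `hasDerivAt_relFisher`).

The mutual information is the difference of the two relative entropies, since the contributions of
`V` cancel. Hence its first two derivatives are differences of dissipations. Let `r` and `R` be the
gradient and Hessian of `log μ_{0|t}` in the end point. Differentiating `∫ μ_{0|t} dx₀ = 1` once and
twice suggests that, given `X_t`, both `r` and `R + r rᵀ` have mean zero (`integral_joint_mul_post`,
`integral_joint_mul_post₂`); they are thus orthogonal to every function of the end point. The
logarithmic gradients and Hessians of the joint density are those of the marginal plus `r` and `R`.
Expanding the squares therefore leaves `E|r|² ≥ 0` in the first derivative. In the second it leaves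
`2 E|R|² + 4 E⟨R, ∇² log μₜ + ∇²V/2⟩`, where the last Hessian is that of `log γₜ`; the other terms
are orthogonal to functions of `X_t` (`dissipation_difference_identity`). Replacing `R` by `-r rᵀ`
in the cross term gives the second form.

The analysis rests on the algebra of `Tame` functions, all of whose powers are bounded against the
density, uniformly in a window of times. Decay in `‖y‖` turns this into one integrable majorant for
the whole window, which permits differentiation under the integral and kills boundary terms. For the
joint density tameness is the hypothesis. For the marginal, the quotients by `μₜ` of its derivatives
are posterior means of tame functions, and Jensen's inequality (`mul_abs_mean_pow_le`) transfers the
bounds. -/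

namespace FPFlow

/-! ### Functions of moderate growth with respect to a family of densities -/

section Tame

variable {Y : Type*}

/-- Every power of `g` is bounded against the family of densities `q`, uniformly for times
in `T`. -/
def Tame (T : Set ℝ) (q g : ℝ → Y → ℝ) : Prop :=
  ∀ m : ℕ, ∃ C : ℝ, ∀ t ∈ T, ∀ y, |q t y| * |g t y| ^ m ≤ C

variable {T : Set ℝ} {q f g : ℝ → Y → ℝ}

lemma Tame.of_abs_le (hg : Tame T q g) (h : ∀ t ∈ T, ∀ y, |f t y| ≤ |g t y|) : Tame T q f := by
  intro m
  obtain ⟨C, hC⟩ := hg m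
  refine ⟨C, fun t ht y => le_trans ?_ (hC t ht y)⟩
  exact mul_le_mul_of_nonneg_left (pow_le_pow_left₀ (abs_nonneg _) (h t ht y) m) (abs_nonneg _)

lemma Tame.congr (hg : Tame T q g) (h : ∀ t ∈ T, ∀ y, f t y = g t y) : Tame T q f :=
  hg.of_abs_le fun t ht y => (congrArg _ (h t ht y)).le

/-- The power `m = 0` of any tame function says that the densities themselves are bounded, which is
all that a constant needs. -/
lemma Tame.const (hg : Tame T q g) (c : ℝ) : Tame T q (fun _ _ => c) := by
  intro m
  obtain ⟨C, hC⟩ := hg 0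
  refine ⟨C * |c| ^ m, fun t ht y => ?_⟩
  have := hC t ht y
  simp only [pow_zero, mul_one] at this
  gcongr

lemma Tame.add (hf : Tame T q f) (hg : Tame T q g) : Tame T q (fun t y => f t y + g t y) := by
  intro m
  obtain ⟨C, hC⟩ := hf m
  obtain ⟨D, hD⟩ := hg m
  refine ⟨2 ^ (m - 1) * (C + D), fun t ht y => ?_⟩
  calc |q t y| * |f t y + g t y| ^ m
      ≤ |q t y| * (2 ^ (m - 1) * (|f t y| ^ m + |g t y| ^ m)) := by
        gcongr
        exact (pow_le_pow_left₀ (abs_nonneg _) (abs_add_le _ _) m).trans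
          (add_pow_le (abs_nonneg _) (abs_nonneg _) m)
    _ = 2 ^ (m - 1) * (|q t y| * |f t y| ^ m + |q t y| * |g t y| ^ m) := by ring
    _ ≤ _ := by
        gcongr
        · exact hC t ht y
        · exact hD t ht y

lemma Tame.mul (hf : Tame T q f) (hg : Tame T q g) : Tame T q (fun t y => f t y * g t y) := by
  intro m
  -- The inequality `ab ≤ a² + b²` splits the product at the price of doubling the exponent, which
  -- is harmless because all powers are controlled.
  obtain ⟨C, hC⟩ := hf (2 * m)
  obtain ⟨D, hD⟩ := hg (2 * m)
  refine ⟨C + D, fun t ht y => ?_⟩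
  calc |q t y| * |f t y * g t y| ^ m
      ≤ |q t y| * (|f t y| ^ (2 * m) + |g t y| ^ (2 * m)) := by
        gcongr
        rw [abs_mul, mul_pow, mul_comm 2 m, pow_mul, pow_mul]
        nlinarith [sq_nonneg (|f t y| ^ m - |g t y| ^ m), sq_nonneg (|f t y| ^ m),
          sq_nonneg (|g t y| ^ m)]
    _ = |q t y| * |f t y| ^ (2 * m) + |q t y| * |g t y| ^ (2 * m) := by ring
    _ ≤ _ := add_le_add (hC t ht y) (hD t ht y)

lemma Tame.const_mul (hg : Tame T q g) (c : ℝ) : Tame T q (fun t y => c * g t y) :=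
  (hg.const c).mul hg

lemma Tame.neg (hg : Tame T q g) : Tame T q (fun t y => -g t y) :=
  hg.of_abs_le fun _ _ _ => (abs_neg _).le

lemma Tame.sub (hf : Tame T q f) (hg : Tame T q g) : Tame T q (fun t y => f t y - g t y) :=
  (hf.add hg.neg).congr fun _ _ _ => sub_eq_add_neg _ _

lemma Tame.pow (hg : Tame T q g) (n : ℕ) : Tame T q (fun t y => g t y ^ n) := by
  induction n with
  | zero => exact (hg.const 1).congr fun _ _ _ => pow_zero _
  | succ n ih => exact (ih.mul hg).congr fun _ _ _ => pow_succ _ _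

lemma Tame.abs (hg : Tame T q g) : Tame T q (fun t y => |g t y|) :=
  hg.of_abs_le fun _ _ _ => (abs_abs _).le

lemma Tame.sum {ι : Type*} (s : Finset ι) {h : ι → ℝ → Y → ℝ} (hg : Tame T q g)
    (hh : ∀ i, Tame T q (h i)) : Tame T q (fun t y => ∑ i ∈ s, h i t y) := by
  classical
  induction s using Finset.induction_on with
  | empty => exact (hg.const 0).congr fun _ _ _ => Finset.sum_empty
  | insert a s ha ih => exact ((hh a).add ih).congr fun _ _ _ => Finset.sum_insert ha

variable [NormedAddCommGroup Y]

/-- Against a rapidly decreasing family of densities, tame functions are dominated by an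
arbitrary negative power of `1 + ‖y‖`. -/
lemma Tame.exists_bound (hg : Tame T q g) (hy : Tame T q (fun _ y => ‖y‖)) (n : ℕ) :
    ∃ C : ℝ, ∀ t ∈ T, ∀ y, |q t y * g t y| ≤ C * (1 + ‖y‖) ^ (-(n : ℝ)) := by
  -- The weight `(1 + ‖y‖)^n` is itself tame, so it can be absorbed into `g` before taking the first
  -- power.
  obtain ⟨C, hC⟩ := (hg.mul (((hy.const 1).add hy).pow n)) 1
  refine ⟨C, fun t ht y => ?_⟩
  have h := hC t ht y
  have hpos : 0 < 1 + ‖y‖ := by positivity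
  rw [Real.rpow_neg hpos.le, Real.rpow_natCast, ← div_eq_mul_inv, le_div_iff₀ (by positivity)]
  simp only [pow_one, abs_mul, abs_of_pos (pow_pos hpos n)] at h
  rw [abs_mul]
  linarith

variable [NormedSpace ℝ Y] [FiniteDimensional ℝ Y] [MeasurableSpace Y] [BorelSpace Y]

/-- An exponent just above the dimension makes the power of `1 + ‖y‖` integrable. The majorant
serves all times of `T` at once, as dominated differentiation requires. -/
lemma Tame.exists_integrable_bound (ν : Measure Y) [ν.IsAddHaarMeasure]
    (hg : Tame T q g) (hy : Tame T q (fun _ y => ‖y‖)) :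
    ∃ b : Y → ℝ, Integrable b ν ∧ ∀ t ∈ T, ∀ y, |q t y * g t y| ≤ b y := by
  obtain ⟨C, hC⟩ := hg.exists_bound hy (Module.finrank ℝ Y + 1)
  refine ⟨_, (integrable_one_add_norm (μ := ν) (r := ((Module.finrank ℝ Y + 1 : ℕ) : ℝ))
    ?_).const_mul C, hC⟩
  push_cast
  linarith

lemma Tame.integrable {ν : Measure Y} [ν.IsAddHaarMeasure]
    (hg : Tame T q g) (hy : Tame T q (fun _ y => ‖y‖)) {t : ℝ} (ht : t ∈ T)
    (hqm : AEStronglyMeasurable (q t) ν) (hgm : AEStronglyMeasurable (g t) ν) :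
    Integrable (fun y => q t y * g t y) ν := by
  obtain ⟨b, hb, hbd⟩ := hg.exists_integrable_bound ν hy
  exact hb.mono' (hqm.mul hgm) (.of_forall fun y => hbd t ht y)

end Tame

/-! ### Differentiation of integrals along a flow in divergence form -/

section Divergence

variable {Y : Type*} [NormedAddCommGroup Y] [NormedSpace ℝ Y] [FiniteDimensional ℝ Y]
  [MeasurableSpace Y] [BorelSpace Y] {ν : Measure Y} [ν.IsAddHaarMeasure]

/-- Integration by parts against the constant `1`: integrability of the function and of its
derivative replaces the discussion of boundary terms. -/
lemma integral_lineDeriv_eq_zero {f f' : Y → ℝ} {v : Y} (hf : Integrable f ν)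
    (hf' : Integrable f' ν) (h : ∀ y, HasLineDerivAt ℝ f (f' y) y v) : ∫ y, f' y ∂ν = 0 := by
  have := integral_bilinear_hasLineDerivAt_right_eq_neg_left_of_integrable (μ := ν)
    (f := fun _ : Y => (1 : ℝ)) (f' := fun _ => 0) (g := f) (g' := f') (v := v)
    (B := ContinuousLinearMap.mul ℝ ℝ) (by simp) (by simpa using hf') (by simpa using hf)
    (fun y _ => by simpa [HasLineDerivAt] using hasDerivAt_const (0 : ℝ) (1 : ℝ)) (fun y _ => h y)
  simpa using this

/-- If `∂ₜ (q f) = ∑ⱼ ∂ⱼ (q Fⱼ) - q k`, then the derivative of `∫ q f` is `- ∫ q k`. -/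
lemma hasDerivAt_integral_of_divergence {ι : Type*} [Fintype ι] {T : Set ℝ} (hT : IsOpen T)
    {e : ι → Y} {q f k : ℝ → Y → ℝ} {F G : ι → ℝ → Y → ℝ}
    (hy : Tame T q (fun _ y => ‖y‖))
    (hqm : ∀ t ∈ T, AEStronglyMeasurable (q t) ν)
    (hf : Tame T q f) (hfm : ∀ t ∈ T, AEStronglyMeasurable (f t) ν)
    (hk : Tame T q k) (hkm : ∀ t ∈ T, AEStronglyMeasurable (k t) ν)
    (hF : ∀ j, Tame T q (F j)) (hFm : ∀ j, ∀ t ∈ T, AEStronglyMeasurable (F j t) ν)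
    (hG : ∀ j, Tame T q (G j)) (hGm : ∀ j, ∀ t ∈ T, AEStronglyMeasurable (G j t) ν)
    (hFG : ∀ j, ∀ t ∈ T, ∀ y,
      HasLineDerivAt ℝ (fun y => q t y * F j t y) (q t y * G j t y) y (e j))
    (hd : ∀ t ∈ T, ∀ y,
      HasDerivAt (fun s => q s y * f s y) (q t y * (∑ j, G j t y - k t y)) t)
    {t : ℝ} (ht : t ∈ T) :
    HasDerivAt (fun s => ∫ y, q s y * f s y ∂ν) (-∫ y, q t y * k t y ∂ν) t := by
  have hh : Tame T q (fun t y => ∑ j, G j t y - k t y) := (hf.sum _ hG).sub hk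
  have hhm : ∀ t ∈ T, AEStronglyMeasurable (fun y => ∑ j, G j t y - k t y) ν := fun t ht =>
    (Finset.aestronglyMeasurable_fun_sum _ fun j _ => hGm j t ht).sub (hkm t ht)
  obtain ⟨b, hb, hbd⟩ := hh.exists_integrable_bound ν hy
  have hTn : T ∈ 𝓝 t := hT.mem_nhds ht
  have key := hasDerivAt_integral_of_dominated_loc_of_deriv_le (μ := ν) (bound := b)
    (F := fun s y => q s y * f s y) (F' := fun s y => q s y * (∑ j, G j s y - k s y)) hTn
    (by filter_upwards [hTn] with s hs using (hqm s hs).mul (hfm s hs))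
    (hf.integrable hy ht (hqm t ht) (hfm t ht))
    ((hqm t ht).mul (hhm t ht))
    (.of_forall fun y s hs => hbd s hs y) hb (.of_forall fun y s hs => hd s hs y)
  refine key.2.congr_deriv ?_
  have hGi : ∀ j, Integrable (fun y => q t y * G j t y) ν := fun j =>
    (hG j).integrable hy ht (hqm t ht) (hGm j t ht)
  simp only [mul_sub, Finset.mul_sum]
  rw [integral_sub (integrable_finsetSum _ fun j _ => hGi j)
    (hk.integrable hy ht (hqm t ht) (hkm t ht)), integral_finsetSum _ fun j _ => hGi j]
  rw [Finset.sum_eq_zero fun j _ => integral_lineDeriv_eq_zero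
    ((hF j).integrable hy ht (hqm t ht) (hFm j t ht)) (hGi j) (hFG j t ht)]
  simp

end Divergence

/-! ### Dissipation of the relative entropy and of the relative Fisher information -/

section LogSystem

variable {Y : Type*} [NormedAddCommGroup Y] [NormedSpace ℝ Y] {N : ℕ}

lemma hasLineDerivAt_congr_val {f : Y → ℝ} {c c' : ℝ} {y v : Y} (h : HasLineDerivAt ℝ f c y v)
    (hc : c = c') : HasLineDerivAt ℝ f c' y v := hc ▸ h

lemma hasLineDerivAt_mul {f g : Y → ℝ} {f' g' : ℝ} {y v : Y} (hf : HasLineDerivAt ℝ f f' y v)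
    (hg : HasLineDerivAt ℝ g g' y v) :
    HasLineDerivAt ℝ (fun y => f y * g y) (f' * g y + f y * g') y v := by
  simpa [HasLineDerivAt] using HasDerivAt.fun_mul hf hg

lemma hasLineDerivAt_add {f g : Y → ℝ} {f' g' : ℝ} {y v : Y} (hf : HasLineDerivAt ℝ f f' y v)
    (hg : HasLineDerivAt ℝ g g' y v) :
    HasLineDerivAt ℝ (fun y => f y + g y) (f' + g') y v := by
  simpa [HasLineDerivAt] using HasDerivAt.fun_add hf hg

lemma hasLineDerivAt_sum {ι : Type*} {s : Finset ι} {f : ι → Y → ℝ} {f' : ι → ℝ} {y v : Y}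
    (hf : ∀ i ∈ s, HasLineDerivAt ℝ (f i) (f' i) y v) :
    HasLineDerivAt ℝ (fun y => ∑ i ∈ s, f i y) (∑ i ∈ s, f' i) y v := by
  simpa [HasLineDerivAt] using HasDerivAt.fun_sum hf

/-- The pointwise algebra of Bochner's identity, divided by the density: `a = ∇φ`, `u` and `U` are
the gradient and Hessian of the potential, and `b i j`, `c i j` are `∂ⱼ∂ᵢφ` and `∂ⱼ∂ⱼ∂ᵢφ`. On the
left is the divergence of the flux `q (|∇φ|² ∇φ + ∇|∇φ|²)` minus the dissipation, on the right the
time derivative of `q |∇φ|²`. -/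
lemma fisher_dissipation_identity (a u : Fin N → ℝ) (b c U : Fin N → Fin N → ℝ) :
    ∑ j, ((a j - u j) * ((∑ i, a i ^ 2) * a j + ∑ i, 2 * (a i * b i j)) +
      ((∑ i, 2 * (a i * b i j)) * a j + (∑ i, a i ^ 2) * b j j +
        ∑ i, 2 * (b i j * b i j + a i * c i j))) -
      2 * ∑ i, ∑ j, (b i j ^ 2 + a i * U i j * a j) =
    (∑ j, (b j j + (a j - u j) * a j)) * ∑ i, a i ^ 2 +
      ∑ i, 2 * a i * ∑ j, (c i j + (b i j - U i j) * a j + (a j - u j) * b i j) := by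
  rw [Finset.sum_mul_sum, Finset.sum_comm (f := fun i j => b i j ^ 2 + a i * U i j * a j),
    Finset.sum_comm (f := fun j i => (b j j + (a j - u j) * a j) * a i ^ 2)]
  simp only [Finset.mul_sum, Finset.sum_mul, ← Finset.sum_add_distrib]
  conv_rhs => rw [Finset.sum_comm]
  rw [← Finset.sum_sub_distrib]
  refine Finset.sum_congr rfl fun j _ => ?_
  rw [← Finset.sum_sub_distrib]
  exact Finset.sum_congr rfl fun i _ => by ring

variable [MeasurableSpace Y]

/-- A rapidly decreasing family of densities `q` on `Y` that evolves along the directions `e i` by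
the Fokker-Planck equation with potential `U`. Here `φ` is the logarithm of the density relative
to `exp (-U)`, and `φ₁ i`, `φ₂ i j`, `φ₃ i j` stand for `∂ᵢ φ`, `∂ⱼ ∂ᵢ φ`, `∂ⱼ ∂ⱼ ∂ᵢ φ`. -/
structure LogFPSystem (ν : Measure Y) (T : Set ℝ) (e : Fin N → Y) (q φ : ℝ → Y → ℝ)
    (φ₁ : Fin N → ℝ → Y → ℝ) (φ₂ φ₃ : Fin N → Fin N → ℝ → Y → ℝ)
    (U₁ : Fin N → Y → ℝ) (U₂ : Fin N → Fin N → Y → ℝ) : Prop where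
  isOpen : IsOpen T
  tame_norm : Tame T q (fun _ y => ‖y‖)
  tame_φ : Tame T q φ
  tame_φ₁ : ∀ i, Tame T q (φ₁ i)
  tame_φ₂ : ∀ i j, Tame T q (φ₂ i j)
  tame_φ₃ : ∀ i j, Tame T q (φ₃ i j)
  tame_U₁ : ∀ i, Tame T q (fun _ => U₁ i)
  tame_U₂ : ∀ i j, Tame T q (fun _ => U₂ i j)
  meas_q : ∀ t ∈ T, AEStronglyMeasurable (q t) ν
  meas_φ : ∀ t ∈ T, AEStronglyMeasurable (φ t) ν
  meas_φ₁ : ∀ i, ∀ t ∈ T, AEStronglyMeasurable (φ₁ i t) ν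
  meas_φ₂ : ∀ i j, ∀ t ∈ T, AEStronglyMeasurable (φ₂ i j t) ν
  meas_φ₃ : ∀ i j, ∀ t ∈ T, AEStronglyMeasurable (φ₃ i j t) ν
  meas_U₁ : ∀ i, AEStronglyMeasurable (U₁ i) ν
  meas_U₂ : ∀ i j, AEStronglyMeasurable (U₂ i j) ν
  line_q : ∀ i, ∀ t ∈ T, ∀ y,
    HasLineDerivAt ℝ (q t) (q t y * (φ₁ i t y - U₁ i y)) y (e i)
  line_φ : ∀ i, ∀ t ∈ T, ∀ y, HasLineDerivAt ℝ (φ t) (φ₁ i t y) y (e i)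
  line_φ₁ : ∀ i j, ∀ t ∈ T, ∀ y, HasLineDerivAt ℝ (φ₁ i t) (φ₂ i j t y) y (e j)
  line_φ₂ : ∀ i j, ∀ t ∈ T, ∀ y, HasLineDerivAt ℝ (φ₂ i j t) (φ₃ i j t y) y (e j)
  -- The three evolution equations are `∂ₜ q = ∇·(q ∇φ)` expanded with `∇q = q (∇φ - ∇U)`, its
  -- quotient by `q`, and the derivative of that quotient in the direction `i`.
  time_q : ∀ t ∈ T, ∀ y, HasDerivAt (fun s => q s y)
    (q t y * ∑ j, (φ₂ j j t y + (φ₁ j t y - U₁ j y) * φ₁ j t y)) t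
  time_φ : ∀ t ∈ T, ∀ y, HasDerivAt (fun s => φ s y)
    (∑ j, (φ₂ j j t y + (φ₁ j t y - U₁ j y) * φ₁ j t y)) t
  time_φ₁ : ∀ i, ∀ t ∈ T, ∀ y, HasDerivAt (fun s => φ₁ i s y)
    (∑ j, (φ₃ i j t y + (φ₂ i j t y - U₂ i j y) * φ₁ j t y +
      (φ₁ j t y - U₁ j y) * φ₂ i j t y)) t

namespace LogFPSystem

variable {ν : Measure Y} {T : Set ℝ} {e : Fin N → Y} {q φ : ℝ → Y → ℝ}
    {φ₁ : Fin N → ℝ → Y → ℝ} {φ₂ φ₃ : Fin N → Fin N → ℝ → Y → ℝ}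
    {U₁ : Fin N → Y → ℝ} {U₂ : Fin N → Fin N → Y → ℝ}

lemma tame_normSq (S : LogFPSystem ν T e q φ φ₁ φ₂ φ₃ U₁ U₂) : Tame T q (fun t y => ∑ i, φ₁ i t y ^ 2) :=
  S.tame_φ.sum _ fun i => (S.tame_φ₁ i).pow 2

lemma meas_normSq (S : LogFPSystem ν T e q φ φ₁ φ₂ φ₃ U₁ U₂) {t : ℝ} (ht : t ∈ T) :
    AEStronglyMeasurable (fun y => ∑ i, φ₁ i t y ^ 2) ν :=
  Finset.aestronglyMeasurable_fun_sum _ fun i _ => (S.meas_φ₁ i t ht).pow 2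

variable [FiniteDimensional ℝ Y] [BorelSpace Y] [ν.IsAddHaarMeasure]

/-- The potential is independent of time, so `q ∂ₜφ = ∂ₜq` and `∂ₜ(qφ) = (φ + 1) ∇·(q∇φ) = ∇·(q (φ +
1) ∇φ) - q |∇φ|²`. -/
theorem hasDerivAt_relEntropy (S : LogFPSystem ν T e q φ φ₁ φ₂ φ₃ U₁ U₂) {t : ℝ} (ht : t ∈ T) :
    HasDerivAt (fun s => ∫ y, q s y * φ s y ∂ν) (-∫ y, q t y * ∑ i, φ₁ i t y ^ 2 ∂ν) t := by
  have h1 := S.tame_φ.const 1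
  refine hasDerivAt_integral_of_divergence S.isOpen (e := e)
    (F := fun j t y => (φ t y + 1) * φ₁ j t y)
    (G := fun j t y => (φ₁ j t y - U₁ j y) * ((φ t y + 1) * φ₁ j t y) + φ₁ j t y * φ₁ j t y
      + (φ t y + 1) * φ₂ j j t y)
    S.tame_norm S.meas_q S.tame_φ S.meas_φ S.tame_normSq (fun t ht => S.meas_normSq ht)
    ?_ ?_ ?_ ?_ ?_ ?_ ht
  · exact fun j => (S.tame_φ.add h1).mul (S.tame_φ₁ j)
  · exact fun j t ht => ((S.meas_φ t ht).add aestronglyMeasurable_const).mul (S.meas_φ₁ j t ht)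
  · exact fun j => ((((S.tame_φ₁ j).sub (S.tame_U₁ j)).mul
      ((S.tame_φ.add h1).mul (S.tame_φ₁ j))).add ((S.tame_φ₁ j).mul (S.tame_φ₁ j))).add
      ((S.tame_φ.add h1).mul (S.tame_φ₂ j j))
  · intro j t ht
    have := S.meas_φ t ht
    have := S.meas_φ₁ j t ht
    have := S.meas_φ₂ j j t ht
    have := S.meas_U₁ j
    fun_prop
  · intro j t ht y
    have hφ : HasLineDerivAt ℝ (fun y => φ t y + 1) (φ₁ j t y) y (e j) := by
      simpa [HasLineDerivAt] using HasDerivAt.add_const (1 : ℝ) (S.line_φ j t ht y)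
    convert hasLineDerivAt_mul (S.line_q j t ht y)
      (hasLineDerivAt_mul hφ (S.line_φ₁ j j t ht y)) using 1
    ring
  · intro t ht y
    refine ((S.time_q t ht y).fun_mul (S.time_φ t ht y)).congr_deriv ?_
    symm
    rw [← Finset.sum_sub_distrib, mul_assoc, ← mul_add, Finset.sum_mul, ← Finset.sum_add_distrib]
    congr 1
    exact Finset.sum_congr rfl fun j _ => by ring

/-- By Bochner's identity, `∂ₜ(q |∇φ|²)` is the divergence of `q (|∇φ|² ∇φ + ∇|∇φ|²)` minus twice `q
(|∇²φ|² + ∇φᵀ ∇²U ∇φ)`. -/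
theorem hasDerivAt_relFisher (S : LogFPSystem ν T e q φ φ₁ φ₂ φ₃ U₁ U₂) {t : ℝ} (ht : t ∈ T) :
    HasDerivAt (fun s => ∫ y, q s y * ∑ i, φ₁ i s y ^ 2 ∂ν)
      (-∫ y, q t y * (2 * ∑ i, ∑ j, (φ₂ i j t y ^ 2 + φ₁ i t y * U₂ i j y * φ₁ j t y)) ∂ν) t := by
  have hk : Tame T q (fun t y =>
      2 * ∑ i, ∑ j, (φ₂ i j t y ^ 2 + φ₁ i t y * U₂ i j y * φ₁ j t y)) :=
    (S.tame_φ.sum _ fun i => S.tame_φ.sum _ fun j => ((S.tame_φ₂ i j).pow 2).add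
      (((S.tame_φ₁ i).mul (S.tame_U₂ i j)).mul (S.tame_φ₁ j))).const_mul 2
  have hgj : ∀ j, Tame T q (fun t y => ∑ i, 2 * (φ₁ i t y * φ₂ i j t y)) := fun j =>
    S.tame_φ.sum _ fun i => ((S.tame_φ₁ i).mul (S.tame_φ₂ i j)).const_mul 2
  have hgjj : ∀ j, Tame T q (fun t y =>
      ∑ i, 2 * (φ₂ i j t y * φ₂ i j t y + φ₁ i t y * φ₃ i j t y)) := fun j =>
    S.tame_φ.sum _ fun i => (((S.tame_φ₂ i j).mul (S.tame_φ₂ i j)).add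
      ((S.tame_φ₁ i).mul (S.tame_φ₃ i j))).const_mul 2
  refine hasDerivAt_integral_of_divergence S.isOpen (e := e)
    (F := fun j t y => (∑ i, φ₁ i t y ^ 2) * φ₁ j t y + ∑ i, 2 * (φ₁ i t y * φ₂ i j t y))
    (G := fun j t y => (φ₁ j t y - U₁ j y) *
        ((∑ i, φ₁ i t y ^ 2) * φ₁ j t y + ∑ i, 2 * (φ₁ i t y * φ₂ i j t y)) +
      ((∑ i, 2 * (φ₁ i t y * φ₂ i j t y)) * φ₁ j t y + (∑ i, φ₁ i t y ^ 2) * φ₂ j j t y +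
        ∑ i, 2 * (φ₂ i j t y * φ₂ i j t y + φ₁ i t y * φ₃ i j t y)))
    S.tame_norm S.meas_q S.tame_normSq (fun t ht => S.meas_normSq ht) hk ?_ ?_ ?_ ?_ ?_ ?_ ?_ ht
  · intro t ht
    have h1 := fun i => S.meas_φ₁ i t ht
    have h2 := fun i j => S.meas_φ₂ i j t ht
    have h3 := S.meas_U₂
    fun_prop
  · exact fun j => (S.tame_normSq.mul (S.tame_φ₁ j)).add (hgj j)
  · intro j t ht
    have h1 := fun i => S.meas_φ₁ i t ht
    have h2 := fun i j => S.meas_φ₂ i j t ht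
    fun_prop
  · exact fun j => (((S.tame_φ₁ j).sub (S.tame_U₁ j)).mul
      ((S.tame_normSq.mul (S.tame_φ₁ j)).add (hgj j))).add
      ((((hgj j).mul (S.tame_φ₁ j)).add (S.tame_normSq.mul (S.tame_φ₂ j j))).add (hgjj j))
  · intro j t ht
    have h1 := fun i => S.meas_φ₁ i t ht
    have h2 := fun i j => S.meas_φ₂ i j t ht
    have h3 := fun i j => S.meas_φ₃ i j t ht
    have h4 := S.meas_U₁
    fun_prop
  · intro j t ht y
    have hg : HasLineDerivAt ℝ (fun y => ∑ i, φ₁ i t y ^ 2)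
        (∑ i, 2 * (φ₁ i t y * φ₂ i j t y)) y (e j) := by
      refine hasLineDerivAt_sum fun i _ => ?_
      simp only [pow_two]
      convert hasLineDerivAt_mul (S.line_φ₁ i j t ht y) (S.line_φ₁ i j t ht y) using 1
      ring
    have hgg : HasLineDerivAt ℝ (fun y => ∑ i, 2 * (φ₁ i t y * φ₂ i j t y))
        (∑ i, 2 * (φ₂ i j t y * φ₂ i j t y + φ₁ i t y * φ₃ i j t y)) y (e j) :=
      hasLineDerivAt_sum fun i _ => HasDerivAt.const_mul 2
        (hasLineDerivAt_mul (S.line_φ₁ i j t ht y) (S.line_φ₂ i j t ht y))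
    convert hasLineDerivAt_mul (S.line_q j t ht y) (hasLineDerivAt_add
      (hasLineDerivAt_mul hg (S.line_φ₁ j j t ht y)) hgg) using 1
    ring
  · intro t ht y
    refine ((S.time_q t ht y).fun_mul (HasDerivAt.fun_sum (u := Finset.univ)
      fun i _ => (S.time_φ₁ i t ht y).fun_pow 2)).congr_deriv ?_
    rw [mul_assoc, ← mul_add, fisher_dissipation_identity]
    simp

end LogFPSystem

end LogSystem

variable {N : ℕ}

/-! ### Smooth functions of time, starting point and end point -/

section Smooth

/-- Positive times, with arbitrary starting and end points. -/
def posTime (N : ℕ) : Set (ℝ × E N × E N) := Ioi 0 ×ˢ univ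

lemma isOpen_posTime : IsOpen (posTime N) := isOpen_Ioi.prod isOpen_univ

lemma mem_posTime {t : ℝ} (ht : 0 < t) (z : E N × E N) : (t, z) ∈ posTime N := ⟨ht, mem_univ _⟩

/-- The derivative in the direction `v`. -/
noncomputable def pd (v : ℝ × E N × E N) (G : ℝ × E N × E N → ℝ) (w : ℝ × E N × E N) : ℝ :=
  fderiv ℝ G w v

/-- The direction of time. -/
abbrev eT : ℝ × E N × E N := (1, 0, 0)

/-- The `i`-th direction of the end point. -/
noncomputable abbrev eX (i : Fin N) : ℝ × E N × E N := (0, 0, EuclideanSpace.single i 1)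

/-- The `i`-th partial derivative of a function on `ℝ^N`. -/
noncomputable def partialD (i : Fin N) (f : E N → ℝ) (x : E N) : ℝ :=
  fderiv ℝ f x (EuclideanSpace.single i 1)

variable {G H : ℝ × E N × E N → ℝ} {v w z : ℝ × E N × E N} {c : ℝ}

lemma contDiffOn_pd (hG : ContDiffOn ℝ ∞ G (posTime N)) (v : ℝ × E N × E N) :
    ContDiffOn ℝ ∞ (pd v G) (posTime N) :=
  (hG.fderiv_of_isOpen isOpen_posTime (m := ∞) (by simp)).clm_apply contDiffOn_const

lemma contDiffAt_of_posTime (hG : ContDiffOn ℝ ∞ G (posTime N)) (hw : w ∈ posTime N) :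
    ContDiffAt ℝ ∞ G w :=
  hG.contDiffAt (isOpen_posTime.mem_nhds hw)

lemma hasFDerivAt_of_posTime (hG : ContDiffOn ℝ ∞ G (posTime N)) (hw : w ∈ posTime N) :
    HasFDerivAt G (fderiv ℝ G w) w :=
  ((contDiffAt_of_posTime hG hw).differentiableAt (by simp)).hasFDerivAt

lemma hasLineDerivAt_pd (hG : ContDiffOn ℝ ∞ G (posTime N)) (hw : w ∈ posTime N)
    (v : ℝ × E N × E N) : HasLineDerivAt ℝ G (pd v G w) w v :=
  (hasFDerivAt_of_posTime hG hw).hasLineDerivAt v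

/-- Since `posTime` is open, identities known only at positive times may be differentiated. -/
lemma pd_eq_of_eqOn (hH : ContDiffOn ℝ ∞ H (posTime N)) (hGH : EqOn G H (posTime N))
    (hw : w ∈ posTime N) (h : HasLineDerivAt ℝ H c w v) : pd v G w = c := by
  have : fderiv ℝ G w = fderiv ℝ H w :=
    (hGH.eventuallyEq_of_mem (isOpen_posTime.mem_nhds hw)).fderiv_eq
  rw [pd, this]
  exact (hasLineDerivAt_pd hH hw v).unique h

lemma pd_comm (hG : ContDiffOn ℝ ∞ G (posTime N)) (hw : w ∈ posTime N)
    (u v : ℝ × E N × E N) : pd u (pd v G) w = pd v (pd u G) w := by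
  have hd : DifferentiableAt ℝ (fderiv ℝ G) w :=
    ((contDiffAt_of_posTime hG hw).fderiv_right (m := ∞) (by simp)).differentiableAt (by simp)
  have key : ∀ u v : ℝ × E N × E N, pd u (pd v G) w = fderiv ℝ (fderiv ℝ G) w u v := by
    intro u v
    have := (hd.hasFDerivAt.clm_apply (hasFDerivAt_const v w)).fderiv
    change fderiv ℝ (fun y => fderiv ℝ G y v) w u = _
    rw [this]
    simp
  rw [key, key]
  exact (contDiffAt_of_posTime hG hw).isSymmSndFDerivAt
    (by rw [minSmoothness_of_isRCLikeNormedField]; exact WithTop.coe_le_coe.2 le_top) u v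

lemma hasDerivAt_dt (hG : ContDiffOn ℝ ∞ G (posTime N)) {t : ℝ} (ht : 0 < t) (y : E N × E N) :
    HasDerivAt (fun s => G (s, y)) (pd eT G (t, y)) t := by
  have h : HasDerivAt (fun s : ℝ => (s, y)) (1, 0) t :=
    (hasDerivAt_id t).prodMk (hasDerivAt_const t y)
  exact (hasFDerivAt_of_posTime hG (mem_posTime ht y)).comp_hasDerivAt t h

lemma hasLineDerivAt_dx (hG : ContDiffOn ℝ ∞ G (posTime N)) {t : ℝ} (ht : 0 < t)
    (y : E N × E N) (i : Fin N) :
    HasLineDerivAt ℝ (fun y => G (t, y)) (pd (eX i) G (t, y)) y (0, EuclideanSpace.single i 1) :=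
  ((hasFDerivAt_of_posTime hG (mem_posTime ht y)).comp y
    (hasFDerivAt_prodMk_right t y)).hasLineDerivAt _

lemma hasFDerivAt_slice (hG : ContDiffOn ℝ ∞ G (posTime N)) {t : ℝ} (ht : 0 < t) (x₀ x : E N) :
    HasFDerivAt (fun y => G (t, x₀, y)) ((fderiv ℝ G (t, x₀, x)).comp
      ((ContinuousLinearMap.inr ℝ ℝ (E N × E N)).comp (ContinuousLinearMap.inr ℝ (E N) (E N)))) x :=
  (hasFDerivAt_of_posTime hG (mem_posTime ht (x₀, x))).comp x
    ((hasFDerivAt_prodMk_right t (x₀, x)).comp x (hasFDerivAt_prodMk_right x₀ x))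

lemma partialD_slice (hG : ContDiffOn ℝ ∞ G (posTime N)) {t : ℝ} (ht : 0 < t) (x₀ : E N)
    (i : Fin N) : partialD i (fun y => G (t, x₀, y)) = fun y => pd (eX i) G (t, x₀, y) := by
  funext x
  rw [partialD, (hasFDerivAt_slice hG ht x₀ x).fderiv]
  rfl

lemma contDiff_slice (hG : ContDiffOn ℝ ∞ G (posTime N)) {t : ℝ} (ht : 0 < t) (x₀ : E N) :
    ContDiff ℝ ∞ (fun y => G (t, x₀, y)) := by
  rw [← contDiffOn_univ]
  exact hG.comp (contDiff_const.prodMk (contDiff_const.prodMk contDiff_id)).contDiffOn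
    fun y _ => mem_posTime ht _

lemma continuous_slice (hG : ContDiffOn ℝ ∞ G (posTime N)) {t : ℝ} (ht : 0 < t) :
    Continuous (fun y : E N × E N => G (t, y)) :=
  hG.continuousOn.comp_continuous (by fun_prop) fun y => mem_posTime ht y

/-- Evaluating the derivative at a unit vector costs one order and no constant; hence bounds on all
orders are inherited by partial derivatives. -/
lemma norm_iteratedFDeriv_partialD_le {f : E N → ℝ} (hf : ContDiff ℝ ∞ f) (i : Fin N) (k : ℕ)
    (x : E N) : ‖iteratedFDeriv ℝ k (partialD i f) x‖ ≤ ‖iteratedFDeriv ℝ (k + 1) f x‖ := by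
  have h := norm_iteratedFDeriv_clm_apply_const (𝕜 := ℝ) (f := fderiv ℝ f)
    (c := EuclideanSpace.single i (1 : ℝ)) (x := x) (n := k) (N := ∞)
    (hf.fderiv_right (m := ∞) (by simp)).contDiffAt (by exact_mod_cast le_top)
  rw [norm_iteratedFDeriv_fderiv] at h
  rw [PiLp.norm_single, norm_one, one_mul] at h
  exact h

lemma contDiff_partialD {f : E N → ℝ} (hf : ContDiff ℝ ∞ f) (i : Fin N) :
    ContDiff ℝ ∞ (partialD i f) :=
  (hf.fderiv_right (m := ∞) (by simp)).clm_apply contDiff_const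

lemma contDiffOn_endPoint {f : E N → ℝ} (hf : ContDiff ℝ ∞ f) :
    ContDiffOn ℝ ∞ (fun w : ℝ × E N × E N => f w.2.2) (posTime N) :=
  (hf.comp (contDiff_snd.comp contDiff_snd)).contDiffOn

lemma hasLineDerivAt_endPoint {f : E N → ℝ} (hf : ContDiff ℝ ∞ f) (i : Fin N)
    (w : ℝ × E N × E N) : HasLineDerivAt ℝ (fun w : ℝ × E N × E N => f w.2.2)
      (partialD i f w.2.2) w (eX i) := by
  have h := (hf.differentiable (by simp) w.2.2).hasFDerivAt.hasLineDerivAt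
    (EuclideanSpace.single i (1 : ℝ))
  simpa [HasLineDerivAt, partialD] using h

lemma partialD_comm {f : E N → ℝ} (hf : ContDiff ℝ ∞ f) (i j : Fin N) (x : E N) :
    partialD i (partialD j f) x = partialD j (partialD i f) x := by
  -- The function is read as one of time, starting point and end point that depends on the end point
  -- only; time `1` is an arbitrary positive time.
  have h1 : ∀ i j : Fin N, partialD i (partialD j f) x =
      pd (eX i) (pd (eX j) fun w => f w.2.2) (1, x, x) := by
    intro i j
    refine (pd_eq_of_eqOn (contDiffOn_endPoint (contDiff_partialD hf j)) (fun w hw => ?_)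
      (mem_posTime one_pos (x, x))
      (hasLineDerivAt_endPoint (contDiff_partialD hf j) i (1, x, x))).symm
    exact pd_eq_of_eqOn (contDiffOn_endPoint hf) (fun _ _ => rfl) hw
      (hasLineDerivAt_endPoint hf j w)
  rw [h1, h1]
  exact pd_comm (contDiffOn_endPoint hf) (mem_posTime one_pos _) _ _

end Smooth

/-! ### Symmetry of the second and third derivatives in the end point -/

section Commute

variable {G : ℝ × E N × E N → ℝ} {w : ℝ × E N × E N}

lemma pd_dx_comm (hG : ContDiffOn ℝ ∞ G (posTime N)) (i j : Fin N) (hw : w ∈ posTime N) :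
    pd (eX i) (pd (eX j) G) w = pd (eX j) (pd (eX i) G) w :=
  pd_comm hG hw _ _

lemma pd_dx_dx_comm (hG : ContDiffOn ℝ ∞ G (posTime N)) (i j : Fin N) (hw : w ∈ posTime N) :
    pd (eX i) (pd (eX j) (pd (eX j) G)) w = pd (eX j) (pd (eX j) (pd (eX i) G)) w := by
  have h := contDiffOn_pd (contDiffOn_pd hG (eX i)) (eX j)
  rw [pd_dx_comm (contDiffOn_pd hG _) i j hw]
  exact pd_eq_of_eqOn h (fun w hw => pd_dx_comm hG i j hw) hw (hasLineDerivAt_pd h hw _)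

lemma partialD_partialD_comm {f : E N → ℝ} (hf : ContDiff ℝ ∞ f) (i j : Fin N) (x : E N) :
    partialD i (partialD j (partialD j f)) x = partialD j (partialD j (partialD i f)) x := by
  rw [partialD_comm (contDiff_partialD hf j), funext (partialD_comm hf i j)]

end Commute

/-! ### The transition density -/

section Transition

variable {V μ₀ : E N → ℝ} {p : ℝ → E N → E N → ℝ}

/-- The transition density as a function of time, starting point and end point. -/
def dens (p : ℝ → E N → E N → ℝ) (w : ℝ × E N × E N) : ℝ := p w.1 w.2.1 w.2.2

/-- The logarithm of the transition density. -/
noncomputable def logDens (p : ℝ → E N → E N → ℝ) (w : ℝ × E N × E N) : ℝ := Real.log (dens p w)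

/-- The joint density as a family of functions on the product. -/
def jointZ (μ₀ : E N → ℝ) (p : ℝ → E N → E N → ℝ) (t : ℝ) (z : E N × E N) : ℝ :=
  μ₀ z.1 * dens p (t, z)

lemma contDiffOn_dens (hp : IsTransitionDensity V p) : ContDiffOn ℝ ∞ (dens p) (posTime N) :=
  hp.smooth

lemma dens_pos (hp : IsTransitionDensity V p) {w : ℝ × E N × E N} (hw : w ∈ posTime N) :
    0 < dens p w := hp.pos _ hw.1 _ _

lemma contDiffOn_logDens (hp : IsTransitionDensity V p) :
    ContDiffOn ℝ ∞ (logDens p) (posTime N) :=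
  (contDiffOn_dens hp).log fun _ hw => (dens_pos hp hw).ne'

lemma pd_dens (hp : IsTransitionDensity V p) (v : ℝ × E N × E N) {w : ℝ × E N × E N}
    (hw : w ∈ posTime N) : pd v (dens p) w = dens p w * pd v (logDens p) w := by
  have hP := hasFDerivAt_of_posTime (contDiffOn_dens hp) hw
  have := (hP.log (dens_pos hp hw).ne').fderiv
  have h2 : pd v (logDens p) w = (dens p w)⁻¹ * pd v (dens p) w := by
    change fderiv ℝ (fun w => Real.log (dens p w)) w v = _
    rw [this]
    simp [pd]
  rw [h2, mul_inv_cancel_left₀ (dens_pos hp hw).ne']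

/-- Since `∂p = p ∂ log p`, differentiation preserves the form of density times cofactor. Iterating
keeps track of the cofactors of all derivatives of `p`. -/
lemma pd_dens_mul (hp : IsTransitionDensity V p) {G H : ℝ × E N × E N → ℝ}
    (hH : ContDiffOn ℝ ∞ H (posTime N)) (hG : EqOn G (fun w => dens p w * H w) (posTime N))
    (v : ℝ × E N × E N) :
    EqOn (pd v G) (fun w => dens p w * (pd v H w + pd v (logDens p) w * H w)) (posTime N) := by
  intro w hw
  refine pd_eq_of_eqOn ((contDiffOn_dens hp).mul hH) hG hw ?_
  refine hasLineDerivAt_congr_val (hasLineDerivAt_mul (hasLineDerivAt_pd (contDiffOn_dens hp) hw v)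
    (hasLineDerivAt_pd hH hw v)) ?_
  rw [pd_dens hp v hw]
  ring

lemma gradient_apply (f : E N → ℝ) (x : E N) (i : Fin N) : (∇ f x) i = partialD i f x := by
  rw [partialD, ← inner_gradient_left, EuclideanSpace.inner_single_right]
  simp

lemma laplacian_eq_sum {f : E N → ℝ} (hf : ContDiff ℝ ∞ f) (x : E N) :
    Laplacian.laplacian f x = ∑ i, partialD i (partialD i f) x := by
  rw [InnerProductSpace.laplacian_eq_iteratedFDeriv_orthonormalBasis f
    (EuclideanSpace.basisFun (Fin N) ℝ)]
  refine Finset.sum_congr rfl fun i _ => ?_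
  rw [iteratedFDeriv_two_apply]
  have hd : DifferentiableAt ℝ (fderiv ℝ f) x :=
    (hf.fderiv_right (m := ∞) (by simp)).differentiable (by simp) x
  have := (hd.hasFDerivAt.clm_apply
    (hasFDerivAt_const (EuclideanSpace.single i (1 : ℝ)) x)).fderiv
  rw [partialD]
  change _ = fderiv ℝ (fun y => fderiv ℝ f y (EuclideanSpace.single i (1 : ℝ))) x _
  rw [this]
  simp

lemma divergence_eq_sum {F : E N → E N} {x : E N} (hF : DifferentiableAt ℝ F x) :
    divergence F x = ∑ i, partialD i (fun y => F y i) x := by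
  refine Finset.sum_congr rfl fun i _ => ?_
  have := ((EuclideanSpace.proj i : E N →L[ℝ] ℝ).hasFDerivAt.comp x
    hF.hasFDerivAt).fderiv
  change _ = fderiv ℝ ((EuclideanSpace.proj i : E N →L[ℝ] ℝ) ∘ F) x _
  rw [this]
  simp

lemma partialD_mul {f g : E N → ℝ} {x : E N} (hf : DifferentiableAt ℝ f x)
    (hg : DifferentiableAt ℝ g x) (i : Fin N) :
    partialD i (fun y => f y * g y) x = partialD i f x * g x + f x * partialD i g x := by
  rw [partialD, fderiv_fun_mul hf hg]
  simp [partialD]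
  ring

/-- The Fokker-Planck equation in coordinates. -/
lemma dt_dens (hV : ContDiff ℝ ∞ V) (hp : IsTransitionDensity V p) :
    EqOn (pd eT (dens p)) (fun w => ∑ j, (pd (eX j) (pd (eX j) (dens p)) w +
      pd (eX j) (dens p) w * partialD j V w.2.2 + dens p w * partialD j (partialD j V) w.2.2))
      (posTime N) := by
  rintro ⟨t, x₀, x⟩ ⟨ht, -⟩
  replace ht : 0 < t := ht
  have hP := contDiffOn_dens hp
  have hs := contDiff_slice hP ht x₀
  rw [(hasDerivAt_dt hP ht (x₀, x)).unique (hp.fokkerPlanck t ht x₀ x)]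
  have hgr : ContDiff ℝ ∞ (∇ V) :=
    (InnerProductSpace.toDual ℝ (E N)).symm.toContinuousLinearEquiv.contDiff.comp
      (hV.fderiv_right (m := ∞) (by simp))
  have hdiv : DifferentiableAt ℝ (fun y => p t x₀ y • ∇ V y) x :=
    (hs.smul hgr).differentiable (by simp) x
  change Laplacian.laplacian (fun y => dens p (t, x₀, y)) x + _ = _
  rw [laplacian_eq_sum hs, divergence_eq_sum hdiv, ← Finset.sum_add_distrib]
  refine Finset.sum_congr rfl fun i _ => ?_
  have h1 : (fun y => (p t x₀ y • ∇ V y) i) = fun y => dens p (t, x₀, y) * partialD i V y := by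
    funext y
    simp [gradient_apply, dens]
  rw [h1, partialD_mul (hs.differentiable (by simp) x)
    ((contDiff_partialD hV i).differentiable (by simp) x), partialD_slice hP ht,
    partialD_slice (contDiffOn_pd hP _) ht, add_assoc]

/-- The Fokker-Planck equation for the logarithm of the transition density. -/
lemma dt_logDens (hV : ContDiff ℝ ∞ V) (hp : IsTransitionDensity V p) :
    EqOn (pd eT (logDens p)) (fun w => ∑ j, (pd (eX j) (pd (eX j) (logDens p)) w +
      partialD j (partialD j V) w.2.2 + pd (eX j) (logDens p) w *
        (pd (eX j) (logDens p) w + partialD j V w.2.2))) (posTime N) := by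
  intro w hw
  have hL := contDiffOn_logDens hp
  have h := dt_dens hV hp hw
  rw [pd_dens hp _ hw] at h
  refine mul_left_cancel₀ (dens_pos hp hw).ne' (h.trans ?_)
  simp only
  rw [Finset.mul_sum]
  refine Finset.sum_congr rfl fun j _ => ?_
  rw [pd_dens_mul hp (contDiffOn_pd hL _) (fun w hw => pd_dens hp _ hw) _ hw, pd_dens hp _ hw]
  ring

/-- The equation for `log p` is differentiated along `eX i`, and symmetry of the derivatives moves
`i` innermost, the order that `LogFPSystem` asks for. -/
lemma dt_dx_logDens (hV : ContDiff ℝ ∞ V) (hp : IsTransitionDensity V p) (i : Fin N) :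
    EqOn (pd eT (pd (eX i) (logDens p))) (fun w => ∑ j, (pd (eX j) (pd (eX j) (pd (eX i) (logDens p))) w +
      partialD j (partialD j (partialD i V)) w.2.2 + pd (eX j) (pd (eX i) (logDens p)) w *
        (pd (eX j) (logDens p) w + partialD j V w.2.2) + pd (eX j) (logDens p) w *
        (pd (eX j) (pd (eX i) (logDens p)) w + partialD j (partialD i V) w.2.2))) (posTime N) := by
  intro w hw
  have hL := contDiffOn_logDens hp
  have hV1 := fun j => contDiff_partialD hV j
  have hV2 := fun j => contDiff_partialD (hV1 j) j
  have hL1 := fun j : Fin N => contDiffOn_pd hL (eX j)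
  have hL2 := fun j : Fin N => contDiffOn_pd (hL1 j) (eX j)
  rw [pd_comm hL hw]
  refine pd_eq_of_eqOn (ContDiffOn.sum fun j _ => ((hL2 j).add (contDiffOn_endPoint (hV2 j))).add
    ((hL1 j).mul ((hL1 j).add (contDiffOn_endPoint (hV1 j))))) (dt_logDens hV hp) hw ?_
  refine hasLineDerivAt_sum fun j _ => ?_
  refine hasLineDerivAt_congr_val (hasLineDerivAt_add (hasLineDerivAt_add
    (hasLineDerivAt_pd (hL2 j) hw _) (hasLineDerivAt_endPoint (hV2 j) i w)) (hasLineDerivAt_mul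
    (hasLineDerivAt_pd (hL1 j) hw _) (hasLineDerivAt_add (hasLineDerivAt_pd (hL1 j) hw _)
      (hasLineDerivAt_endPoint (hV1 j) i w)))) ?_
  rw [pd_dx_comm hL i j hw, pd_dx_dx_comm hL i j hw, partialD_comm hV i j,
    partialD_partialD_comm hV i j]
  ring

end Transition

/-! ### The joint density as a Fokker-Planck system -/

section Joint

variable {V μ₀ : E N → ℝ} {p : ℝ → E N → E N → ℝ} {a b : ℝ}

/-- All derivatives of `G` in the end point are tame. -/
def JetTame (T : Set ℝ) (q : ℝ → E N × E N → ℝ) (G : ℝ × E N × E N → ℝ) : Prop :=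
  ∀ k, Tame T q (fun t z => ‖iteratedFDeriv ℝ k (fun y => G (t, z.1, y)) z.2‖)

lemma JetTame.tame {T : Set ℝ} {q : ℝ → E N × E N → ℝ} {G : ℝ × E N × E N → ℝ}
    (h : JetTame T q G) : Tame T q (fun t z => G (t, z)) :=
  (h 0).of_abs_le fun t _ z => by simp

lemma JetTame.pd {T : Set ℝ} {q : ℝ → E N × E N → ℝ} {G : ℝ × E N × E N → ℝ}
    (h : JetTame T q G) (hT : T ⊆ Ioi 0) (hG : ContDiffOn ℝ ∞ G (posTime N)) (i : Fin N) :
    JetTame T q (pd (eX i) G) := by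
  refine fun k => (h (k + 1)).of_abs_le fun t ht z => ?_
  rw [abs_norm, abs_norm, ← partialD_slice hG (hT ht)]
  exact norm_iteratedFDeriv_partialD_le (contDiff_slice hG (hT ht) _) i k _

lemma JetTame.partialD {T : Set ℝ} {q : ℝ → E N × E N → ℝ} {f : E N → ℝ}
    (h : JetTame T q (fun w => f w.2.2)) (hf : ContDiff ℝ ∞ f) (i : Fin N) :
    JetTame T q (fun w => partialD i f w.2.2) := by
  refine fun k => (h (k + 1)).of_abs_le fun t ht z => ?_
  rw [abs_norm, abs_norm]
  exact norm_iteratedFDeriv_partialD_le hf i k _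

lemma jointZ_nonneg (hμ₀ : IsProbDensity μ₀) (hp : IsTransitionDensity V p) {t : ℝ} (ht : 0 < t)
    (z : E N × E N) : 0 ≤ jointZ μ₀ p t z :=
  mul_nonneg (hμ₀.nonneg _) (dens_pos hp (mem_posTime ht z)).le

lemma tame_decay (hμ₀ : IsProbDensity μ₀) (hp : IsTransitionDensity V p)
    (hdecay : RapidlyDecreasing V μ₀ p) (ha : 0 < a) (k : ℕ) :
    Tame (Ioo a b) (jointZ μ₀ p) (fun t z => ‖z.1‖ + ‖z.2‖ + ‖iteratedFDeriv ℝ k V z.2‖ +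
        ‖iteratedFDeriv ℝ k (fun y => logDens p (t, z.1, y)) z.2‖) := by
  intro m
  obtain ⟨C, hC⟩ := hdecay a b ha k m
  refine ⟨C, fun t ht z => ?_⟩
  have h := hC t (Ioo_subset_Icc_self ht) z.1 z.2
  rw [abs_of_nonneg (jointZ_nonneg hμ₀ hp (ha.trans ht.1) z), abs_of_nonneg (by positivity)]
  exact h

lemma tame_norm_jointZ (hμ₀ : IsProbDensity μ₀) (hp : IsTransitionDensity V p)
    (hdecay : RapidlyDecreasing V μ₀ p) (ha : 0 < a) :
    Tame (Ioo a b) (jointZ μ₀ p) (fun _ z => ‖z‖) := by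
  refine (tame_decay hμ₀ hp hdecay ha 0).of_abs_le fun t ht z => ?_
  rw [abs_norm, abs_of_nonneg (by positivity), Prod.norm_def]
  have h1 := norm_nonneg z.1
  have h2 := norm_nonneg z.2
  have h3 := norm_nonneg (iteratedFDeriv ℝ 0 V z.2)
  have h4 := norm_nonneg (iteratedFDeriv ℝ 0 (fun y => logDens p (t, z.1, y)) z.2)
  exact max_le (by linarith) (by linarith)

lemma jetTame_logDens (hμ₀ : IsProbDensity μ₀) (hp : IsTransitionDensity V p)
    (hdecay : RapidlyDecreasing V μ₀ p) (ha : 0 < a) :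
    JetTame (Ioo a b) (jointZ μ₀ p) (logDens p) := by
  refine fun k => (tame_decay hμ₀ hp hdecay ha k).of_abs_le fun t ht z => ?_
  rw [abs_norm, abs_of_nonneg (by positivity)]
  exact le_add_of_nonneg_left (by positivity)

lemma jetTame_potential (hμ₀ : IsProbDensity μ₀) (hp : IsTransitionDensity V p)
    (hdecay : RapidlyDecreasing V μ₀ p) (ha : 0 < a) :
    JetTame (Ioo a b) (jointZ μ₀ p) (fun w => V w.2.2) := by
  refine fun k => (tame_decay hμ₀ hp hdecay ha k).of_abs_le fun t ht z => ?_
  rw [abs_norm, abs_of_nonneg (by positivity)]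
  change ‖iteratedFDeriv ℝ k V z.2‖ ≤ _
  have h1 := norm_nonneg z.1
  have h2 := norm_nonneg z.2
  have h4 := norm_nonneg (iteratedFDeriv ℝ k (fun y => logDens p (t, z.1, y)) z.2)
  linarith

lemma aestronglyMeasurable_slice {G : ℝ × E N × E N → ℝ} (hG : ContDiffOn ℝ ∞ G (posTime N))
    {t : ℝ} (ht : 0 < t) :
    AEStronglyMeasurable (fun z : E N × E N => G (t, z)) volume :=
  (continuous_slice hG ht).aestronglyMeasurable

lemma measurable_jointZ (hμ₀ : IsProbDensity μ₀) (hp : IsTransitionDensity V p) {t : ℝ}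
    (ht : 0 < t) : Measurable (jointZ μ₀ p t) :=
  (hμ₀.measurable.comp measurable_fst).mul (continuous_slice (contDiffOn_dens hp) ht).measurable

lemma hasLineDerivAt_snd {f : E N → ℝ} (hf : ContDiff ℝ ∞ f) (i : Fin N) (z : E N × E N) :
    HasLineDerivAt ℝ (fun z : E N × E N => f z.2) (partialD i f z.2) z
      (0, EuclideanSpace.single i 1) := by
  have h := (hf.differentiable (by simp) z.2).hasFDerivAt.hasLineDerivAt
    (EuclideanSpace.single i (1 : ℝ))
  simpa [HasLineDerivAt, FPFlow.partialD] using h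

/-- The directions `(0, eᵢ)` leave the starting point fixed, so `μ₀` is a constant factor. It is
kept out of `φ = log p + V`; hence neither positivity nor smoothness of `μ₀` is needed. -/
theorem logFPSystem_joint (hV : ContDiff ℝ ∞ V) (hμ₀ : IsProbDensity μ₀)
    (hp : IsTransitionDensity V p) (hdecay : RapidlyDecreasing V μ₀ p) (ha : 0 < a) :
    LogFPSystem volume (Ioo a b) (fun i => ((0, EuclideanSpace.single i 1) : E N × E N))
      (jointZ μ₀ p) (fun t z => logDens p (t, z) + V z.2)
      (fun i t z => pd (eX i) (logDens p) (t, z) + partialD i V z.2)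
      (fun i j t z => pd (eX j) (pd (eX i) (logDens p)) (t, z) + partialD j (partialD i V) z.2)
      (fun i j t z => pd (eX j) (pd (eX j) (pd (eX i) (logDens p))) (t, z) +
        partialD j (partialD j (partialD i V)) z.2)
      (fun i z => partialD i V z.2) (fun i j z => partialD j (partialD i V) z.2) := by
  have hT : Ioo a b ⊆ Ioi 0 := fun t ht => ha.trans ht.1
  have hL := contDiffOn_logDens hp
  have hL1 := fun i : Fin N => contDiffOn_pd hL (eX i)
  have hL2 := fun i j : Fin N => contDiffOn_pd (hL1 i) (eX j)
  have hL3 := fun i j : Fin N => contDiffOn_pd (hL2 i j) (eX j)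
  have hV1 := fun i => contDiff_partialD hV i
  have hV2 := fun i j => contDiff_partialD (hV1 i) j
  have hV3 := fun i j => contDiff_partialD (hV2 i j) j
  have tL := jetTame_logDens (b := b) hμ₀ hp hdecay ha
  have tL1 := fun i => tL.pd hT hL i
  have tL2 := fun i j => (tL1 i).pd hT (hL1 i) j
  have tL3 := fun i j => (tL2 i j).pd hT (hL2 i j) j
  have tV := jetTame_potential (b := b) hμ₀ hp hdecay ha
  have tV1 := fun i => tV.partialD hV i
  have tV2 := fun i j => (tV1 i).partialD (hV1 i) j
  have tV3 := fun i j => (tV2 i j).partialD (hV2 i j) j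
  have mV : ∀ f : E N → ℝ, ContDiff ℝ ∞ f →
      AEStronglyMeasurable (fun z : E N × E N => f z.2) volume := fun f hf =>
    (hf.continuous.comp continuous_snd).aestronglyMeasurable
  refine
    { isOpen := isOpen_Ioo
      tame_norm := tame_norm_jointZ hμ₀ hp hdecay ha
      tame_φ := tL.tame.add tV.tame
      tame_φ₁ := fun i => (tL1 i).tame.add (tV1 i).tame
      tame_φ₂ := fun i j => (tL2 i j).tame.add (tV2 i j).tame
      tame_φ₃ := fun i j => (tL3 i j).tame.add (tV3 i j).tame
      tame_U₁ := fun i => (tV1 i).tame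
      tame_U₂ := fun i j => (tV2 i j).tame
      meas_q := fun t ht => (measurable_jointZ hμ₀ hp (hT ht)).aestronglyMeasurable
      meas_φ := fun t ht => (aestronglyMeasurable_slice hL (hT ht)).add (mV _ hV)
      meas_φ₁ := fun i t ht => (aestronglyMeasurable_slice (hL1 i) (hT ht)).add (mV _ (hV1 i))
      meas_φ₂ := fun i j t ht =>
        (aestronglyMeasurable_slice (hL2 i j) (hT ht)).add (mV _ (hV2 i j))
      meas_φ₃ := fun i j t ht =>
        (aestronglyMeasurable_slice (hL3 i j) (hT ht)).add (mV _ (hV3 i j))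
      meas_U₁ := fun i => mV _ (hV1 i)
      meas_U₂ := fun i j => mV _ (hV2 i j)
      line_q := fun i t ht z => ?_
      line_φ := fun i t ht z => hasLineDerivAt_add (hasLineDerivAt_dx hL (hT ht) z i)
        (hasLineDerivAt_snd hV i z)
      line_φ₁ := fun i j t ht z => hasLineDerivAt_add (hasLineDerivAt_dx (hL1 i) (hT ht) z j)
        (hasLineDerivAt_snd (hV1 i) j z)
      line_φ₂ := fun i j t ht z => hasLineDerivAt_add (hasLineDerivAt_dx (hL2 i j) (hT ht) z j)
        (hasLineDerivAt_snd (hV2 i j) j z)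
      time_q := fun t ht z => ?_
      time_φ := fun t ht z => ?_
      time_φ₁ := fun i t ht z => ?_ }
  · have h1 : HasLineDerivAt ℝ (fun z : E N × E N => μ₀ z.1) 0 z
        (0, EuclideanSpace.single i 1) := by
      simpa [HasLineDerivAt] using hasDerivAt_const (0 : ℝ) (μ₀ z.1)
    refine hasLineDerivAt_congr_val
      (hasLineDerivAt_mul h1 (hasLineDerivAt_dx (contDiffOn_dens hp) (hT ht) z i)) ?_
    rw [pd_dens hp _ (mem_posTime (hT ht) z), jointZ]
    ring
  · refine ((hasDerivAt_dt (contDiffOn_dens hp) (hT ht) z).const_mul (μ₀ z.1)).congr_deriv ?_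
    have hw := mem_posTime (hT ht) z
    rw [pd_dens hp _ hw, dt_logDens hV hp hw, jointZ, mul_assoc]
    simp only [add_sub_cancel_right]
  · refine ((hasDerivAt_dt hL (hT ht) z).add_const (V z.2)).congr_deriv ?_
    rw [dt_logDens hV hp (mem_posTime (hT ht) z)]
    simp only [add_sub_cancel_right]
  · refine ((hasDerivAt_dt (hL1 i) (hT ht) z).add_const (partialD i V z.2)).congr_deriv ?_
    rw [dt_dx_logDens hV hp i (mem_posTime (hT ht) z)]
    simp only [add_sub_cancel_right]

end Joint

/-! ### Averages over the starting point -/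

section Average

variable {V μ₀ : E N → ℝ} {p : ℝ → E N → E N → ℝ} {a b : ℝ} {T : Set ℝ}
  {q : ℝ → E N × E N → ℝ} {G H : ℝ × E N × E N → ℝ}

lemma JetTame.add (hG : JetTame T q G) (hH : JetTame T q H) (hT : T ⊆ Ioi 0)
    (sG : ContDiffOn ℝ ∞ G (posTime N)) (sH : ContDiffOn ℝ ∞ H (posTime N)) :
    JetTame T q (fun w => G w + H w) := by
  refine fun k => ((hG k).add (hH k)).of_abs_le fun t ht z => ?_
  have h := iteratedFDeriv_add_apply (𝕜 := ℝ) (i := k) (x := z.2)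
    ((contDiff_slice sG (hT ht) z.1).of_le (mod_cast le_top)).contDiffAt
    ((contDiff_slice sH (hT ht) z.1).of_le (mod_cast le_top)).contDiffAt
  rw [abs_norm, abs_of_nonneg (by positivity)]
  change ‖iteratedFDeriv ℝ k ((fun y => G (t, z.1, y)) + fun y => H (t, z.1, y)) z.2‖ ≤ _
  rw [h]
  exact norm_add_le _ _

/-- Leibniz' rule bounds each derivative of the product by a finite sum of products of tame
functions. -/
lemma JetTame.mul (hG : JetTame T q G) (hH : JetTame T q H) (hT : T ⊆ Ioi 0)
    (sG : ContDiffOn ℝ ∞ G (posTime N)) (sH : ContDiffOn ℝ ∞ H (posTime N)) :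
    JetTame T q (fun w => G w * H w) := by
  intro k
  have hb : Tame T q (fun t z => ∑ i ∈ Finset.range (k + 1), (k.choose i : ℝ) *
      ‖iteratedFDeriv ℝ i (fun y => G (t, z.1, y)) z.2‖ *
      ‖iteratedFDeriv ℝ (k - i) (fun y => H (t, z.1, y)) z.2‖) :=
    (hG 0).sum _ fun i => ((hG i).const_mul _).mul (hH (k - i))
  refine hb.of_abs_le fun t ht z => ?_
  rw [abs_norm]
  refine (norm_iteratedFDeriv_mul_le (𝕜 := ℝ) (N := ∞) (contDiff_slice sG (hT ht) z.1)
    (contDiff_slice sH (hT ht) z.1) z.2 (mod_cast le_top)).trans (le_abs_self _)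

lemma JetTame.sum {ι : Type*} (s : Finset ι) {F : ι → ℝ × E N × E N → ℝ} (hG : JetTame T q G)
    (hF : ∀ i, JetTame T q (F i)) (hT : T ⊆ Ioi 0)
    (sF : ∀ i, ContDiffOn ℝ ∞ (F i) (posTime N)) : JetTame T q (fun w => ∑ i ∈ s, F i w) := by
  classical
  induction s using Finset.induction_on with
  | empty =>
    intro k
    refine ((hG 0).const 0).congr fun t _ z => ?_
    simp only [Finset.sum_empty]
    rw [iteratedFDeriv_fun_zero]
    simp
  | insert i s hi ih =>
    simp only [Finset.sum_insert hi]
    exact (hF i).add ih hT (sF i) (ContDiffOn.sum fun j _ => sF j)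

lemma JetTame.one (hG : JetTame T q G) : JetTame T q (fun _ => 1) := by
  intro k
  rcases Nat.eq_zero_or_pos k with rfl | hk
  · exact ((hG 0).const 1).congr fun t _ z => by simp
  · refine ((hG 0).const 0).congr fun t _ z => ?_
    rw [iteratedFDeriv_const_of_ne hk.ne']
    simp

/-- `G` is the product of the transition density and of a function with tame derivatives. -/
def DensTame (T : Set ℝ) (μ₀ : E N → ℝ) (p : ℝ → E N → E N → ℝ) (G : ℝ × E N × E N → ℝ) : Prop :=
  ∃ H, ContDiffOn ℝ ∞ H (posTime N) ∧ JetTame T (jointZ μ₀ p) H ∧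
    EqOn G (fun w => dens p w * H w) (posTime N)

lemma DensTame.pd_eX (hp : IsTransitionDensity V p) (hT : T ⊆ Ioi 0)
    (hL : JetTame T (jointZ μ₀ p) (logDens p)) (hG : DensTame T μ₀ p G) (i : Fin N) :
    DensTame T μ₀ p (pd (eX i) G) := by
  obtain ⟨H, sH, tH, eH⟩ := hG
  have sL := contDiffOn_logDens hp
  refine ⟨_, (contDiffOn_pd sH _).add ((contDiffOn_pd sL _).mul sH), ?_, pd_dens_mul hp sH eH _⟩
  exact (tH.pd hT sH i).add ((hL.pd hT sL i).mul tH hT (contDiffOn_pd sL _) sH) hT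
    (contDiffOn_pd sH _) ((contDiffOn_pd sL _).mul sH)

lemma densTame_dens (hL : JetTame T (jointZ μ₀ p) (logDens p)) : DensTame T μ₀ p (dens p) :=
  ⟨_, contDiffOn_const, hL.one, fun _ _ => (mul_one _).symm⟩

/-- The decay hypothesis controls no time derivative; the Fokker-Planck equation expresses `∂ₜ p /
p` through tame derivatives in the end point. -/
lemma densTame_dt_dens (hV : ContDiff ℝ ∞ V) (hp : IsTransitionDensity V p) (hT : T ⊆ Ioi 0)
    (hL : JetTame T (jointZ μ₀ p) (logDens p))
    (hVt : JetTame T (jointZ μ₀ p) (fun w => V w.2.2)) : DensTame T μ₀ p (pd eT (dens p)) := by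
  have sL := contDiffOn_logDens hp
  have sL1 := fun j : Fin N => contDiffOn_pd sL (eX j)
  have sL2 := fun j : Fin N => contDiffOn_pd (sL1 j) (eX j)
  have hV1 := fun j => contDiff_partialD hV j
  have hV2 := fun j => contDiff_partialD (hV1 j) j
  have sV1 := fun j => contDiffOn_endPoint (hV1 j)
  have sV2 := fun j => contDiffOn_endPoint (hV2 j)
  have tL1 := fun j => hL.pd hT sL j
  have tL2 := fun j => (tL1 j).pd hT (sL1 j) j
  have tV1 := fun j => hVt.partialD hV j
  have tV2 := fun j => (tV1 j).partialD (hV1 j) j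
  have hs := fun j => ((sL2 j).add (sV2 j)).add ((sL1 j).mul ((sL1 j).add (sV1 j)))
  refine ⟨_, ContDiffOn.sum (s := Finset.univ) fun j _ => hs j, hL.sum _ (fun j => ?_) hT hs,
    fun w hw => ?_⟩
  · exact ((tL2 j).add (tV2 j) hT (sL2 j) (sV2 j)).add ((tL1 j).mul
      ((tL1 j).add (tV1 j) hT (sL1 j) (sV1 j)) hT (sL1 j) ((sL1 j).add (sV1 j))) hT
      ((sL2 j).add (sV2 j)) ((sL1 j).mul ((sL1 j).add (sV1 j)))
  · rw [pd_dens hp _ hw, dt_logDens hV hp hw]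

lemma DensTame.congr {G' : ℝ × E N × E N → ℝ} (hG : DensTame T μ₀ p G)
    (h : EqOn G' G (posTime N)) : DensTame T μ₀ p G' := by
  obtain ⟨H, sH, tH, eH⟩ := hG
  exact ⟨H, sH, tH, h.trans eH⟩

/-- Tame functions are dominated by an integrable function of the starting point. -/
lemma Tame.exists_bound_fst {h : ℝ → E N × E N → ℝ} (hh : Tame T q h)
    (hy : Tame T q (fun _ z => ‖z‖)) :
    ∃ b : E N → ℝ, Integrable b ∧ ∀ t ∈ T, ∀ x₀ x, |q t (x₀, x) * h t (x₀, x)| ≤ b x₀ := by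
  -- The exponent exceeds the dimension of one factor only: dropping `x` from `‖(x₀, x)‖` leaves a
  -- bound independent of `x`, to be integrated over `x₀` alone.
  obtain ⟨C, hC⟩ := hh.exists_bound hy (Module.finrank ℝ (E N) + 1)
  refine ⟨fun x₀ => |C| * (1 + ‖x₀‖) ^ (-((Module.finrank ℝ (E N) + 1 : ℕ) : ℝ)),
    (integrable_one_add_norm (by push_cast; linarith)).const_mul _, fun t ht x₀ x => ?_⟩
  refine (hC t ht (x₀, x)).trans ?_
  refine mul_le_mul (le_abs_self C) ?_ (by positivity) (abs_nonneg _)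
  refine Real.rpow_le_rpow_of_nonpos (by positivity) ?_ (neg_nonpos.2 (Nat.cast_nonneg _))
  have : ‖x₀‖ ≤ ‖(x₀, x)‖ := norm_fst_le (x₀, x)
  linarith

lemma DensTame.exists_bound (hT : T ⊆ Ioi 0) (hG : DensTame T μ₀ p G)
    (hy : Tame T (jointZ μ₀ p) (fun _ z => ‖z‖)) :
    ∃ b : E N → ℝ, Integrable b ∧ ∀ t ∈ T, ∀ x₀ x, |μ₀ x₀ * G (t, x₀, x)| ≤ b x₀ := by
  obtain ⟨H, sH, tH, eH⟩ := hG
  obtain ⟨b, hb, hbd⟩ := tH.tame.exists_bound_fst hy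
  refine ⟨b, hb, fun t ht x₀ x => ?_⟩
  rw [eH (mem_posTime (hT ht) (x₀, x)), ← mul_assoc]
  exact hbd t ht x₀ x

/-- The average of `G` over the starting point. -/
noncomputable def avg (μ₀ : E N → ℝ) (G : ℝ × E N × E N → ℝ) (t : ℝ) (x : E N) : ℝ :=
  ∫ x₀, μ₀ x₀ * G (t, x₀, x)

lemma measurable_slice_fst (hG : ContDiffOn ℝ ∞ G (posTime N)) (hμ₀ : IsProbDensity μ₀) {t : ℝ}
    (ht : 0 < t) (x : E N) : Measurable (fun x₀ => μ₀ x₀ * G (t, x₀, x)) :=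
  hμ₀.measurable.mul ((continuous_slice hG ht).comp (Continuous.prodMk_left x)).measurable

lemma DensTame.integrable (hT : T ⊆ Ioi 0) (hμ₀ : IsProbDensity μ₀)
    (sG : ContDiffOn ℝ ∞ G (posTime N)) (hG : DensTame T μ₀ p G)
    (hy : Tame T (jointZ μ₀ p) (fun _ z => ‖z‖)) {t : ℝ} (ht : t ∈ T) (x : E N) :
    Integrable (fun x₀ => μ₀ x₀ * G (t, x₀, x)) := by
  obtain ⟨b, hb, hbd⟩ := hG.exists_bound hT hy
  exact hb.mono' (measurable_slice_fst sG hμ₀ (hT ht) x).aestronglyMeasurable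
    (.of_forall fun x₀ => hbd t ht x₀ x)

lemma hasDerivAt_avg (hTo : IsOpen T) (hT : T ⊆ Ioi 0) (hμ₀ : IsProbDensity μ₀)
    (sG : ContDiffOn ℝ ∞ G (posTime N)) (hG : DensTame T μ₀ p G)
    (hG' : DensTame T μ₀ p (pd eT G))
    (hy : Tame T (jointZ μ₀ p) (fun _ z => ‖z‖)) {t : ℝ} (ht : t ∈ T) (x : E N) :
    HasDerivAt (fun s => avg μ₀ G s x) (avg μ₀ (pd eT G) t x) t := by
  obtain ⟨b, hb, hbd⟩ := hG'.exists_bound hT hy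
  have hTn : T ∈ 𝓝 t := hTo.mem_nhds ht
  exact (hasDerivAt_integral_of_dominated_loc_of_deriv_le (bound := b)
    (F := fun s x₀ => μ₀ x₀ * G (s, x₀, x)) (F' := fun s x₀ => μ₀ x₀ * pd eT G (s, x₀, x)) hTn
    (by filter_upwards [hTn] with s hs using
      (measurable_slice_fst sG hμ₀ (hT hs) x).aestronglyMeasurable)
    (hG.integrable hT hμ₀ sG hy ht x)
    (measurable_slice_fst (contDiffOn_pd sG _) hμ₀ (hT ht) x).aestronglyMeasurable
    (.of_forall fun x₀ s hs => hbd s hs x₀ x) hb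
    (.of_forall fun x₀ s hs => (hasDerivAt_dt sG (hT hs) (x₀, x)).const_mul _)).2

/-- Lets majorants of the partial derivatives dominate the Fréchet derivative when averages over the
starting point are differentiated. -/
lemma norm_clm_le_sum (A : E N →L[ℝ] ℝ) : ‖A‖ ≤ ∑ i, |A (EuclideanSpace.single i 1)| := by
  refine A.opNorm_le_bound (Finset.sum_nonneg fun i _ => abs_nonneg _) fun v => ?_
  have hv : v = ∑ i, v i • EuclideanSpace.single i (1 : ℝ) := by
    simpa using ((EuclideanSpace.basisFun (Fin N) ℝ).sum_repr v).symm
  conv_lhs => rw [hv]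
  rw [map_sum, Finset.sum_mul]
  refine (norm_sum_le _ _).trans (Finset.sum_le_sum fun i _ => ?_)
  rw [map_smul, norm_smul, mul_comm]
  exact mul_le_mul_of_nonneg_left (PiLp.norm_apply_le v i) (abs_nonneg _)

lemma hasFDerivAt_avg (hT : T ⊆ Ioi 0) (hμ₀ : IsProbDensity μ₀)
    (sG : ContDiffOn ℝ ∞ G (posTime N)) (hG : DensTame T μ₀ p G)
    (hG' : ∀ i, DensTame T μ₀ p (pd (eX i) G))
    (hy : Tame T (jointZ μ₀ p) (fun _ z => ‖z‖)) {t : ℝ} (ht : t ∈ T) (x : E N) :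
    DifferentiableAt ℝ (avg μ₀ G t) x ∧
      ∀ i, partialD i (avg μ₀ G t) x = avg μ₀ (pd (eX i) G) t x := by
  choose b hb hbd using fun i => (hG' i).exists_bound hT hy
  let J : E N →L[ℝ] ℝ × E N × E N :=
    (ContinuousLinearMap.inr ℝ ℝ (E N × E N)).comp (ContinuousLinearMap.inr ℝ (E N) (E N))
  let F' : E N → E N → E N →L[ℝ] ℝ := fun x x₀ => μ₀ x₀ • (fderiv ℝ G (t, x₀, x)).comp J
  have hF'm : AEStronglyMeasurable (F' x) volume := by
    refine hμ₀.measurable.aestronglyMeasurable.smul (Continuous.aestronglyMeasurable ?_)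
    refine Continuous.clm_comp ?_ continuous_const
    exact (sG.fderiv_of_isOpen isOpen_posTime (m := ∞) (by simp)).continuousOn.comp_continuous (by fun_prop) fun x₀ => mem_posTime (hT ht) (x₀, x)
  have hbound : ∀ x₀ x, ‖F' x x₀‖ ≤ ∑ i, b i x₀ := fun x₀ x =>
    (norm_clm_le_sum _).trans (Finset.sum_le_sum fun i _ => hbd i t ht x₀ x)
  have hbi : Integrable (fun x₀ => ∑ i, b i x₀) := integrable_finsetSum _ fun i _ => hb i
  have key : HasFDerivAt (avg μ₀ G t) (∫ x₀, F' x x₀) x :=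
    hasFDerivAt_integral_of_dominated_of_fderiv_le (s := univ)
    (F := fun x x₀ => μ₀ x₀ * G (t, x₀, x)) univ_mem
    (.of_forall fun x => (measurable_slice_fst sG hμ₀ (hT ht) x).aestronglyMeasurable)
    (hG.integrable hT hμ₀ sG hy ht x) hF'm
    (.of_forall fun x₀ x _ => hbound x₀ x) hbi
    (.of_forall fun x₀ x _ => (hasFDerivAt_slice sG (hT ht) x₀ x).const_mul _)
  refine ⟨key.differentiableAt, fun i => ?_⟩
  rw [partialD, key.fderiv, ContinuousLinearMap.integral_apply]
  · rfl
  · exact hbi.mono' hF'm (.of_forall fun x₀ => hbound x₀ x)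

lemma avg_congr {G' : ℝ × E N × E N → ℝ} (h : EqOn G G' (posTime N)) {t : ℝ} (ht : 0 < t)
    (x : E N) : avg μ₀ G t x = avg μ₀ G' t x :=
  integral_congr_ae (.of_forall fun x₀ => by simp only [h (mem_posTime ht (x₀, x))])

lemma measurable_avg (hG : ContDiffOn ℝ ∞ G (posTime N)) (hμ₀ : IsProbDensity μ₀) {t : ℝ}
    (ht : 0 < t) : StronglyMeasurable (avg μ₀ G t) := by
  have h : StronglyMeasurable (fun z : E N × E N => μ₀ z.1 * G (t, z)) :=
    ((hμ₀.measurable.comp measurable_fst).mul (continuous_slice hG ht).measurable).stronglyMeasurable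
  exact h.integral_prod_left'

/-- The transition density is positive, so the integrand has the support of `μ₀`, which has positive
measure because `∫ μ₀ = 1`. -/
lemma avg_dens_pos (hT : T ⊆ Ioi 0) (hμ₀ : IsProbDensity μ₀) (hp : IsTransitionDensity V p)
    (hG : DensTame T μ₀ p (dens p)) (hy : Tame T (jointZ μ₀ p) (fun _ z => ‖z‖)) {t : ℝ}
    (ht : t ∈ T) (x : E N) : 0 < avg μ₀ (dens p) t x := by
  have hpos := fun x₀ : E N => dens_pos hp (mem_posTime (hT ht) (x₀, x))
  rw [avg, integral_pos_iff_support_of_nonneg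
    (fun x₀ => mul_nonneg (hμ₀.nonneg x₀) (hpos x₀).le)
    (hG.integrable hT hμ₀ (contDiffOn_dens hp) hy ht x)]
  have hs : (Function.support fun x₀ => μ₀ x₀ * dens p (t, x₀, x)) = Function.support μ₀ := by
    ext x₀
    simp [(hpos x₀).ne']
  rw [hs, ← integral_pos_iff_support_of_nonneg hμ₀.nonneg
    (Integrable.of_integral_ne_zero (by rw [hμ₀.integral_eq_one]; exact one_ne_zero)),
    hμ₀.integral_eq_one]
  exact one_pos

/-- Jensen's inequality for powers of weighted means. -/
lemma mul_abs_mean_pow_le {α : Type*} [MeasurableSpace α] {ν : Measure α} {w f : α → ℝ}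
    (hw : ∀ y, 0 ≤ w y) (hwi : Integrable w ν) (hwf : Integrable (fun y => w y * f y) ν) (m : ℕ)
    (hwm : Integrable (fun y => w y * |f y| ^ m) ν) (hpos : 0 < ∫ y, w y ∂ν) :
    (∫ y, w y ∂ν) * |(∫ y, w y * f y ∂ν) / ∫ y, w y ∂ν| ^ m ≤ ∫ y, w y * |f y| ^ m ∂ν := by
  set W := ∫ y, w y ∂ν
  have habs : Integrable (fun y => w y * |f y|) ν := by
    refine hwf.abs.congr (.of_forall fun y => ?_)
    simp only [abs_mul, abs_of_nonneg (hw y)]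
  set c := (∫ y, w y * |f y| ∂ν) / W with hc
  have hc0 : 0 ≤ c := div_nonneg (integral_nonneg fun y => mul_nonneg (hw y) (abs_nonneg _)) hpos.le
  have hle : |(∫ y, w y * f y ∂ν) / W| ≤ c := by
    rw [abs_div, abs_of_pos hpos, hc]
    gcongr
    refine abs_integral_le_integral_abs.trans (le_of_eq ?_)
    simp only [abs_mul, fun y => abs_of_nonneg (hw y)]
  refine (mul_le_mul_of_nonneg_left (pow_le_pow_left₀ (abs_nonneg _) hle m) hpos.le).trans ?_
  rcases Nat.eq_zero_or_pos m with rfl | hm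
  · simp [W]
  rcases hc0.eq_or_lt with h0 | hcpos
  · rw [← h0, zero_pow hm.ne', mul_zero]
    exact integral_nonneg fun y => mul_nonneg (hw y) (by positivity)
  -- The left side is the tangent to `s ↦ s^m` at `s = c`, the mean of `|f|`, evaluated at `|f y|`
  -- and weighted by `w`; the inequality is Bernoulli's for `|f y| / c`. Its integral is exactly `W
  -- * c ^ m`.
  have hpt : ∀ y, c ^ m * ((1 - m) * w y + m / c * (w y * |f y|)) ≤ w y * |f y| ^ m := by
    intro y
    have hB := one_add_mul_le_pow (a := |f y| / c - 1)
      (by have := div_nonneg (abs_nonneg (f y)) hcpos.le; linarith) m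
    rw [add_sub_cancel, div_pow, le_div_iff₀ (by positivity)] at hB
    calc c ^ m * ((1 - m) * w y + m / c * (w y * |f y|))
        = w y * ((1 + m * (|f y| / c - 1)) * c ^ m) := by ring
      _ ≤ _ := mul_le_mul_of_nonneg_left hB (hw y)
  have hint := integral_mono
    (((hwi.const_mul (1 - (m : ℝ))).add (habs.const_mul (m / c))).const_mul (c ^ m)) hwm hpt
  refine le_trans (le_of_eq ?_) hint
  rw [integral_const_mul, integral_add' (hwi.const_mul _) (habs.const_mul _), integral_const_mul,
    integral_const_mul]
  have : ∫ y, w y * |f y| ∂ν = c * W := by rw [hc, div_mul_cancel₀ _ hpos.ne']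
  rw [this]
  field_simp
  ring

end Average

/-! ### The marginal density as a Fokker-Planck system -/

section Marginal

variable {V μ₀ : E N → ℝ} {p : ℝ → E N → E N → ℝ} {a b : ℝ} {T : Set ℝ}
  {G : ℝ × E N × E N → ℝ}

/-- A function of the end point passes through the average over `x₀`, so the bound against the joint
density, with an integrable majorant in `x₀`, simply integrates. -/
lemma tame_avg_endPoint (hy : Tame T (jointZ μ₀ p) (fun _ z => ‖z‖)) {f : E N → ℝ}
    (hf : Tame T (jointZ μ₀ p) (fun _ z => f z.2)) : Tame T (avg μ₀ (dens p)) (fun _ => f) := by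
  intro m
  obtain ⟨b, hb, hbd⟩ := (hf.abs.pow m).exists_bound_fst hy
  refine ⟨∫ x₀, b x₀, fun t ht x => ?_⟩
  rw [← abs_of_nonneg (pow_nonneg (abs_nonneg (f x)) m), ← abs_mul, avg, ← integral_mul_const]
  exact norm_integral_le_of_norm_le (f := fun x₀ => μ₀ x₀ * dens p (t, x₀, x) * |f x| ^ m) hb
    (.of_forall fun x₀ => hbd t ht x₀ x)

/-- With `G = p H`, the quotient is the posterior mean of `H`. Jensen's inequality bounds its `m`-th
power against `μₜ` by the average of `|H|^m` against the joint density, whose majorant does not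
depend on `x`. -/
lemma tame_avg_div (hT : T ⊆ Ioi 0) (hμ₀ : IsProbDensity μ₀) (hp : IsTransitionDensity V p)
    (hy : Tame T (jointZ μ₀ p) (fun _ z => ‖z‖)) (hd : DensTame T μ₀ p (dens p))
    (sG : ContDiffOn ℝ ∞ G (posTime N)) (hG : DensTame T μ₀ p G) :
    Tame T (avg μ₀ (dens p)) (fun t x => avg μ₀ G t x / avg μ₀ (dens p) t x) := by
  have hGi := fun t (ht : t ∈ T) x => hG.integrable hT hμ₀ sG hy ht x
  obtain ⟨H, sH, tH, eH⟩ := hG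
  intro m
  obtain ⟨b, hb, hbd⟩ := (tH.tame.abs.pow m).exists_bound_fst hy
  refine ⟨∫ x₀, b x₀, fun t ht x => ?_⟩
  have hpos := avg_dens_pos hT hμ₀ hp hd hy ht x
  have hGeq : (fun x₀ => μ₀ x₀ * G (t, x₀, x)) =
      fun x₀ => μ₀ x₀ * dens p (t, x₀, x) * H (t, x₀, x) := by
    funext x₀
    rw [eH (mem_posTime (hT ht) (x₀, x)), mul_assoc]
  have hi := hGi t ht x
  have hm : Integrable (fun x₀ => μ₀ x₀ * dens p (t, x₀, x) * |H (t, x₀, x)| ^ m) := by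
    refine hb.mono' ?_ (.of_forall fun x₀ => hbd t ht x₀ x)
    refine ((measurable_slice_fst (contDiffOn_dens hp) hμ₀ (hT ht) x).mul
      (Measurable.pow_const ?_ m)).aestronglyMeasurable
    exact (((continuous_slice sH (hT ht)).comp (Continuous.prodMk_left x)).abs).measurable
  rw [abs_of_pos hpos]
  rw [hGeq] at hi
  have key := mul_abs_mean_pow_le
    (fun x₀ => jointZ_nonneg hμ₀ hp (hT ht) (x₀, x))
    (hd.integrable hT hμ₀ (contDiffOn_dens hp) hy ht x) hi m hm hpos
  have hGa : avg μ₀ G t x = ∫ x₀, μ₀ x₀ * dens p (t, x₀, x) * H (t, x₀, x) := by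
    rw [avg, hGeq]
  simp only [hGa]
  refine key.trans ((le_abs_self _).trans ?_)
  exact norm_integral_le_of_norm_le
    (f := fun x₀ => μ₀ x₀ * dens p (t, x₀, x) * |H (t, x₀, x)| ^ m) hb
    (.of_forall fun x₀ => hbd t ht x₀ x)

/-- Below `1`, the bound `x^(1/m) |log x| ≤ m` is raised to the power `m`, which gives `m^m`; above
`1`, `log x ≤ x - 1 ≤ C`. -/
lemma mul_abs_log_pow_le {C x : ℝ} (hx : 0 < x) (hC : x ≤ C) (m : ℕ) :
    x * |Real.log x| ^ m ≤ C * C ^ m + C + (m : ℝ) ^ m := by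
  have hC0 : 0 < C := hx.trans_le hC
  have hm0 : (0 : ℝ) ≤ (m : ℝ) ^ m := by positivity
  rcases le_total x 1 with h1 | h1
  · rcases Nat.eq_zero_or_pos m with rfl | hm
    · simp
      linarith
    · have hmp : (0 : ℝ) < m := by exact_mod_cast hm
      have h := (Real.abs_log_mul_self_rpow_lt x (1 / m) hx h1 (by positivity)).le
      have h2 := pow_le_pow_left₀ (abs_nonneg _) h m
      rw [abs_mul, mul_pow, abs_of_pos (Real.rpow_pos_of_pos hx _), ← Real.rpow_natCast (x ^ _),
        ← Real.rpow_mul hx.le, one_div, inv_mul_cancel₀ hmp.ne', Real.rpow_one, one_div,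
        inv_inv] at h2
      have : 0 ≤ C * C ^ m := by positivity
      linarith
  · have hl : |Real.log x| ≤ C := by
      rw [abs_of_nonneg (Real.log_nonneg h1)]
      linarith [Real.log_le_sub_one_of_pos hx]
    have : x * |Real.log x| ^ m ≤ C * C ^ m := by gcongr
    linarith

/-- The logarithm of an average is not a posterior mean, so Jensen's inequality is of no use here. A
positive bounded density always controls the powers of its own logarithm. -/
lemma tame_log_avg (hT : T ⊆ Ioi 0) (hμ₀ : IsProbDensity μ₀) (hp : IsTransitionDensity V p)
    (hy : Tame T (jointZ μ₀ p) (fun _ z => ‖z‖)) (hd : DensTame T μ₀ p (dens p)) :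
    Tame T (avg μ₀ (dens p)) (fun t x => Real.log (avg μ₀ (dens p) t x)) := by
  obtain ⟨C, hC⟩ := (tame_avg_endPoint hy (f := fun _ => 1) (hy.const 1)) 0
  refine fun m => ⟨C * C ^ m + C + (m : ℝ) ^ m, fun t ht x => ?_⟩
  have hpos := avg_dens_pos hT hμ₀ hp hd hy ht x
  have h := hC t ht x
  rw [pow_zero, mul_one] at h
  rw [abs_of_pos hpos] at h ⊢
  exact mul_abs_log_pow_le hpos h m

lemma dt_dx_dens (hV : ContDiff ℝ ∞ V) (hp : IsTransitionDensity V p) (i : Fin N) :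
    EqOn (pd eT (pd (eX i) (dens p))) (fun w => ∑ j, (pd (eX j) (pd (eX j) (pd (eX i) (dens p))) w +
      pd (eX j) (pd (eX i) (dens p)) w * partialD j V w.2.2 +
      pd (eX j) (dens p) w * partialD j (partialD i V) w.2.2 +
      pd (eX i) (dens p) w * partialD j (partialD j V) w.2.2 +
      dens p w * partialD j (partialD j (partialD i V)) w.2.2)) (posTime N) := by
  intro w hw
  have hL := contDiffOn_dens hp
  have hV1 := fun j => contDiff_partialD hV j
  have hV2 := fun j => contDiff_partialD (hV1 j) j
  have hL1 := fun j : Fin N => contDiffOn_pd hL (eX j)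
  have hL2 := fun j : Fin N => contDiffOn_pd (hL1 j) (eX j)
  rw [pd_comm hL hw]
  refine pd_eq_of_eqOn (ContDiffOn.sum fun j _ => ((hL2 j).add
    ((hL1 j).mul (contDiffOn_endPoint (hV1 j)))).add (hL.mul (contDiffOn_endPoint (hV2 j))))
    (dt_dens hV hp) hw ?_
  refine hasLineDerivAt_sum fun j _ => ?_
  refine hasLineDerivAt_congr_val (hasLineDerivAt_add (hasLineDerivAt_add
    (hasLineDerivAt_pd (hL2 j) hw _) (hasLineDerivAt_mul (hasLineDerivAt_pd (hL1 j) hw _)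
      (hasLineDerivAt_endPoint (hV1 j) i w))) (hasLineDerivAt_mul
    (hasLineDerivAt_pd hL hw _) (hasLineDerivAt_endPoint (hV2 j) i w))) ?_
  rw [pd_dx_comm hL i j hw, pd_dx_dx_comm hL i j hw, partialD_comm hV i j,
    partialD_partialD_comm hV i j]
  ring

lemma integrable_avg_term (hT : T ⊆ Ioi 0) (hμ₀ : IsProbDensity μ₀)
    (sG : ContDiffOn ℝ ∞ G (posTime N)) (hG : DensTame T μ₀ p G)
    (hy : Tame T (jointZ μ₀ p) (fun _ z => ‖z‖)) {t : ℝ} (ht : t ∈ T) (x : E N) (c : ℝ) :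
    Integrable (fun x₀ => μ₀ x₀ * (G (t, x₀, x) * c)) := by
  simpa only [mul_assoc] using (hG.integrable hT hμ₀ sG hy ht x).mul_const c

lemma integral_avg_term (t : ℝ) (x : E N) (c : ℝ) :
    ∫ x₀, μ₀ x₀ * (G (t, x₀, x) * c) = avg μ₀ G t x * c := by
  simp only [← mul_assoc]
  exact integral_mul_const c _

lemma hasLineDerivAt_div {f g : E N → ℝ} {f' g' : ℝ} {y v : E N} (hf : HasLineDerivAt ℝ f f' y v)
    (hg : HasLineDerivAt ℝ g g' y v) (h0 : g y ≠ 0) :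
    HasLineDerivAt ℝ (fun y => f y / g y) (f' / g y - f y / g y * (g' / g y)) y v := by
  have := HasDerivAt.fun_div hf hg (by simpa using h0)
  refine hasLineDerivAt_congr_val this ?_
  simp only [zero_smul, add_zero]
  field_simp

/-- The derivative `∂ᵢ log μₜ` of the logarithm of the marginal density. -/
noncomputable def score (μ₀ : E N → ℝ) (p : ℝ → E N → E N → ℝ) (i : Fin N) (t : ℝ) (x : E N) : ℝ :=
  avg μ₀ (pd (eX i) (dens p)) t x / avg μ₀ (dens p) t x

/-- The derivative `∂ⱼ ∂ᵢ log μₜ` of the logarithm of the marginal density. -/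
noncomputable def score₂ (μ₀ : E N → ℝ) (p : ℝ → E N → E N → ℝ) (i j : Fin N) (t : ℝ)
    (x : E N) : ℝ :=
  avg μ₀ (pd (eX j) (pd (eX i) (dens p))) t x / avg μ₀ (dens p) t x -
    score μ₀ p i t x * score μ₀ p j t x

/-- The derivative `∂ⱼ ∂ⱼ ∂ᵢ log μₜ` of the logarithm of the marginal density. -/
noncomputable def score₃ (μ₀ : E N → ℝ) (p : ℝ → E N → E N → ℝ) (i j : Fin N) (t : ℝ)
    (x : E N) : ℝ :=
  avg μ₀ (pd (eX j) (pd (eX j) (pd (eX i) (dens p)))) t x / avg μ₀ (dens p) t x -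
    avg μ₀ (pd (eX j) (pd (eX i) (dens p))) t x / avg μ₀ (dens p) t x * score μ₀ p j t x -
    (score₂ μ₀ p i j t x * score μ₀ p j t x + score μ₀ p i t x * score₂ μ₀ p j j t x)

lemma hasLineDerivAt_avg (hT : T ⊆ Ioi 0) (hμ₀ : IsProbDensity μ₀)
    (sG : ContDiffOn ℝ ∞ G (posTime N)) (hG : DensTame T μ₀ p G)
    (hG' : ∀ i, DensTame T μ₀ p (pd (eX i) G))
    (hy : Tame T (jointZ μ₀ p) (fun _ z => ‖z‖)) {t : ℝ} (ht : t ∈ T) (x : E N) (i : Fin N) :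
    HasLineDerivAt ℝ (avg μ₀ G t) (avg μ₀ (pd (eX i) G) t x) x (EuclideanSpace.single i 1) := by
  obtain ⟨h1, h2⟩ := hasFDerivAt_avg hT hμ₀ sG hG hG' hy ht x
  exact hasLineDerivAt_congr_val (h1.hasFDerivAt.hasLineDerivAt _) (h2 i)

lemma hasLineDerivAt_potential {f : E N → ℝ} (hf : ContDiff ℝ ∞ f) (i : Fin N) (x : E N) :
    HasLineDerivAt ℝ f (partialD i f x) x (EuclideanSpace.single i 1) :=
  (hf.differentiable (by simp) x).hasFDerivAt.hasLineDerivAt _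

/-- The equation for `p`, unlike the one for `log p`, is linear with coefficients depending on `x`
only, so it survives averaging over the starting point. -/
lemma avg_dt_dens (hV : ContDiff ℝ ∞ V) (hμ₀ : IsProbDensity μ₀) (hp : IsTransitionDensity V p)
    (hT : T ⊆ Ioi 0) (hL : JetTame T (jointZ μ₀ p) (logDens p))
    (hy : Tame T (jointZ μ₀ p) (fun _ z => ‖z‖)) {t : ℝ} (ht : t ∈ T) (x : E N) :
    avg μ₀ (pd eT (dens p)) t x = ∑ j, (avg μ₀ (pd (eX j) (pd (eX j) (dens p))) t x +
      avg μ₀ (pd (eX j) (dens p)) t x * partialD j V x +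
      avg μ₀ (dens p) t x * partialD j (partialD j V) x) := by
  have s0 := contDiffOn_dens hp
  have s1 := fun j : Fin N => contDiffOn_pd s0 (eX j)
  have s2 := fun j : Fin N => contDiffOn_pd (s1 j) (eX j)
  have d0 := densTame_dens hL
  have d1 := fun j => d0.pd_eX hp hT hL j
  have d2 := fun j => (d1 j).pd_eX hp hT hL j
  rw [avg_congr (dt_dens hV hp) (hT ht), avg]
  simp only [Finset.mul_sum, mul_add]
  have i2 := fun j => (d2 j).integrable hT hμ₀ (s2 j) hy ht x
  have i1 := fun j => integrable_avg_term hT hμ₀ (s1 j) (d1 j) hy ht x (partialD j V x)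
  have i0 := fun j => integrable_avg_term hT hμ₀ s0 d0 hy ht x (partialD j (partialD j V) x)
  rw [integral_finsetSum _ fun j _ => ((i2 j).fun_add (i1 j)).fun_add (i0 j)]
  refine Finset.sum_congr rfl fun j _ => ?_
  rw [integral_add ((i2 j).fun_add (i1 j)) (i0 j), integral_add (i2 j) (i1 j), integral_avg_term,
    integral_avg_term]
  rfl

lemma avg_dt_dx_dens (hV : ContDiff ℝ ∞ V) (hμ₀ : IsProbDensity μ₀)
    (hp : IsTransitionDensity V p) (hT : T ⊆ Ioi 0) (hL : JetTame T (jointZ μ₀ p) (logDens p))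
    (hy : Tame T (jointZ μ₀ p) (fun _ z => ‖z‖)) {t : ℝ} (ht : t ∈ T) (x : E N) (i : Fin N) :
    avg μ₀ (pd eT (pd (eX i) (dens p))) t x =
      ∑ j, (avg μ₀ (pd (eX j) (pd (eX j) (pd (eX i) (dens p)))) t x +
      avg μ₀ (pd (eX j) (pd (eX i) (dens p))) t x * partialD j V x +
      avg μ₀ (pd (eX j) (dens p)) t x * partialD j (partialD i V) x +
      avg μ₀ (pd (eX i) (dens p)) t x * partialD j (partialD j V) x +
      avg μ₀ (dens p) t x * partialD j (partialD j (partialD i V)) x) := by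
  have s0 := contDiffOn_dens hp
  have s1 := fun j : Fin N => contDiffOn_pd s0 (eX j)
  have s2 := fun j : Fin N => contDiffOn_pd (s1 i) (eX j)
  have s3 := fun j : Fin N => contDiffOn_pd (s2 j) (eX j)
  have d0 := densTame_dens hL
  have d1 := fun j => d0.pd_eX hp hT hL j
  have d2 := fun j => (d1 i).pd_eX hp hT hL j
  have d3 := fun j => (d2 j).pd_eX hp hT hL j
  rw [avg_congr (dt_dx_dens hV hp i) (hT ht), avg]
  simp only [Finset.mul_sum, mul_add]
  have i4 := fun j => (d3 j).integrable hT hμ₀ (s3 j) hy ht x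
  have i3 := fun j => integrable_avg_term hT hμ₀ (s2 j) (d2 j) hy ht x (partialD j V x)
  have i2 := fun j => integrable_avg_term hT hμ₀ (s1 j) (d1 j) hy ht x
    (partialD j (partialD i V) x)
  have i1 := fun j => integrable_avg_term hT hμ₀ (s1 i) (d1 i) hy ht x
    (partialD j (partialD j V) x)
  have i0 := fun j => integrable_avg_term hT hμ₀ s0 d0 hy ht x
    (partialD j (partialD j (partialD i V)) x)
  rw [integral_finsetSum _ fun j _ => ((((i4 j).fun_add (i3 j)).fun_add (i2 j)).fun_add (i1 j)).fun_add (i0 j)]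
  refine Finset.sum_congr rfl fun j _ => ?_
  rw [integral_add ((((i4 j).fun_add (i3 j)).fun_add (i2 j)).fun_add (i1 j)) (i0 j),
    integral_add (((i4 j).fun_add (i3 j)).fun_add (i2 j)) (i1 j),
    integral_add ((i4 j).fun_add (i3 j)) (i2 j), integral_add (i4 j) (i3 j), integral_avg_term,
    integral_avg_term, integral_avg_term, integral_avg_term]
  rfl

/-- The averaged equation is the Fokker-Planck equation for `μₜ`. The derivatives of `log μₜ` are
polynomials in quotients of averages, and these quotients are tame as posterior means. -/
theorem logFPSystem_marginal (hV : ContDiff ℝ ∞ V) (hμ₀ : IsProbDensity μ₀)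
    (hp : IsTransitionDensity V p) (hdecay : RapidlyDecreasing V μ₀ p) (ha : 0 < a) :
    LogFPSystem volume (Ioo a b) (fun i => (EuclideanSpace.single i 1 : E N))
      (avg μ₀ (dens p)) (fun t x => Real.log (avg μ₀ (dens p) t x) + V x)
      (fun i t x => score μ₀ p i t x + partialD i V x)
      (fun i j t x => score₂ μ₀ p i j t x + partialD j (partialD i V) x)
      (fun i j t x => score₃ μ₀ p i j t x + partialD j (partialD j (partialD i V)) x)
      (fun i => partialD i V) (fun i j => partialD j (partialD i V)) := by
  have hT : Ioo a b ⊆ Ioi 0 := fun t ht => ha.trans ht.1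
  have s0 := contDiffOn_dens hp
  have s1 := fun i : Fin N => contDiffOn_pd s0 (eX i)
  have s2 := fun i j : Fin N => contDiffOn_pd (s1 i) (eX j)
  have s3 := fun i j : Fin N => contDiffOn_pd (s2 i j) (eX j)
  have hV1 := fun i => contDiff_partialD hV i
  have hV2 := fun i j => contDiff_partialD (hV1 i) j
  have hV3 := fun i j => contDiff_partialD (hV2 i j) j
  have tL := jetTame_logDens (b := b) hμ₀ hp hdecay ha
  have tV := jetTame_potential (b := b) hμ₀ hp hdecay ha
  have hy := tame_norm_jointZ (b := b) hμ₀ hp hdecay ha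
  have d0 := densTame_dens tL
  have d1 := fun i => d0.pd_eX hp hT tL i
  have d2 := fun i j => (d1 i).pd_eX hp hT tL j
  have d2' := fun i j k => (d2 i j).pd_eX hp hT tL k
  have dT := densTame_dt_dens hV hp hT tL tV
  -- Tameness is known for end point derivatives of `∂ₜ p`; the symmetry of second derivatives turns
  -- `∂ᵢ∂ₜ p` into `∂ₜ∂ᵢ p`.
  have dT1 : ∀ i, DensTame (Ioo a b) μ₀ p (pd eT (pd (eX i) (dens p))) := fun i =>
    (dT.pd_eX hp hT tL i).congr fun w hw => pd_comm s0 hw _ _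
  have hpos := fun t (ht : t ∈ Ioo a b) x => avg_dens_pos hT hμ₀ hp d0 hy ht x
  have tV0 := tame_avg_endPoint hy tV.tame
  have tV1 := fun i => tame_avg_endPoint hy (tV.partialD hV i).tame
  have tV2 := fun i j =>
    tame_avg_endPoint hy ((tV.partialD hV i).partialD (hV1 i) j).tame
  have tV3 := fun i j => tame_avg_endPoint hy
    (((tV.partialD hV i).partialD (hV1 i) j).partialD (hV2 i j) j).tame
  have tn : Tame (Ioo a b) (avg μ₀ (dens p)) (fun _ x => ‖x‖) :=
    tame_avg_endPoint hy (f := fun x => ‖x‖) (hy.of_abs_le fun t _ z => by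
      rw [abs_norm, abs_norm]; exact norm_snd_le z)
  have tR1 : ∀ i, Tame (Ioo a b) (avg μ₀ (dens p)) (score μ₀ p i) := fun i =>
    tame_avg_div hT hμ₀ hp hy d0 (s1 i) (d1 i)
  have tR2 := fun i j => tame_avg_div hT hμ₀ hp hy d0 (s2 i j) (d2 i j)
  have tR3 := fun i j => tame_avg_div hT hμ₀ hp hy d0 (s3 i j) (d2' i j j)
  have tS2 : ∀ i j, Tame (Ioo a b) (avg μ₀ (dens p)) (score₂ μ₀ p i j) := fun i j =>
    (tR2 i j).sub ((tR1 i).mul (tR1 j))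
  have tS3 : ∀ i j, Tame (Ioo a b) (avg μ₀ (dens p)) (score₃ μ₀ p i j) := fun i j =>
    ((tR3 i j).sub ((tR2 i j).mul (tR1 j))).sub
      (((tS2 i j).mul (tR1 j)).add ((tR1 i).mul (tS2 j j)))
  have m0 := fun t (ht : t ∈ Ioo a b) => (measurable_avg s0 hμ₀ (hT ht)).measurable
  have m1 : ∀ i, ∀ t ∈ Ioo a b, Measurable (score μ₀ p i t) := fun i t ht =>
    (measurable_avg (s1 i) hμ₀ (hT ht)).measurable.div (m0 t ht)
  have mR2 := fun i j t (ht : t ∈ Ioo a b) =>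
    (measurable_avg (s2 i j) hμ₀ (hT ht)).measurable.div (m0 t ht)
  have mR3 := fun i j t (ht : t ∈ Ioo a b) =>
    (measurable_avg (s3 i j) hμ₀ (hT ht)).measurable.div (m0 t ht)
  have m2 : ∀ i j, ∀ t ∈ Ioo a b, Measurable (score₂ μ₀ p i j t) := fun i j t ht =>
    (mR2 i j t ht).sub ((m1 i t ht).mul (m1 j t ht))
  have m3 : ∀ i j, ∀ t ∈ Ioo a b, Measurable (score₃ μ₀ p i j t) := fun i j t ht =>
    ((mR3 i j t ht).sub ((mR2 i j t ht).mul (m1 j t ht))).sub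
      (((m2 i j t ht).mul (m1 j t ht)).add ((m1 i t ht).mul (m2 j j t ht)))
  have l0 := fun t (ht : t ∈ Ioo a b) x i => hasLineDerivAt_avg hT hμ₀ s0 d0 d1 hy ht x i
  have l1 : ∀ i j, ∀ t ∈ Ioo a b, ∀ x, HasLineDerivAt ℝ (score μ₀ p i t) (score₂ μ₀ p i j t x) x
      (EuclideanSpace.single j 1) := fun i j t ht x =>
    hasLineDerivAt_div (hasLineDerivAt_avg hT hμ₀ (s1 i) (d1 i) (d2 i) hy ht x j) (l0 t ht x j)
      (hpos t ht x).ne'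
  have l2 : ∀ i j, ∀ t ∈ Ioo a b, ∀ x, HasLineDerivAt ℝ (score₂ μ₀ p i j t)
      (score₃ μ₀ p i j t x) x (EuclideanSpace.single j 1) := fun i j t ht x =>
    HasDerivAt.fun_sub (hasLineDerivAt_div
      (hasLineDerivAt_avg hT hμ₀ (s2 i j) (d2 i j) (d2' i j) hy ht x j) (l0 t ht x j)
      (hpos t ht x).ne') (hasLineDerivAt_mul (l1 i j t ht x) (l1 j j t ht x))
  have tm0 := fun t (ht : t ∈ Ioo a b) x => hasDerivAt_avg isOpen_Ioo hT hμ₀ s0 d0 dT hy ht x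
  refine
    { isOpen := isOpen_Ioo
      tame_norm := tn
      tame_φ := (tame_log_avg hT hμ₀ hp hy d0).add tV0
      tame_φ₁ := fun i => (tR1 i).add (tV1 i)
      tame_φ₂ := fun i j => (tS2 i j).add (tV2 i j)
      tame_φ₃ := fun i j => (tS3 i j).add (tV3 i j)
      tame_U₁ := tV1
      tame_U₂ := tV2
      meas_q := fun t ht => (m0 t ht).aestronglyMeasurable
      meas_φ := fun t ht => ((m0 t ht).log.add hV.continuous.measurable).aestronglyMeasurable
      meas_φ₁ := fun i t ht => ((m1 i t ht).add (hV1 i).continuous.measurable).aestronglyMeasurable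
      meas_φ₂ := fun i j t ht =>
        ((m2 i j t ht).add (hV2 i j).continuous.measurable).aestronglyMeasurable
      meas_φ₃ := fun i j t ht =>
        ((m3 i j t ht).add (hV3 i j).continuous.measurable).aestronglyMeasurable
      meas_U₁ := fun i => (hV1 i).continuous.aestronglyMeasurable
      meas_U₂ := fun i j => (hV2 i j).continuous.aestronglyMeasurable
      line_q := fun i t ht x => hasLineDerivAt_congr_val (l0 t ht x i) ?_
      line_φ := fun i t ht x => ?_
      line_φ₁ := fun i j t ht x =>
        hasLineDerivAt_add (l1 i j t ht x) (hasLineDerivAt_potential (hV1 i) j x)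
      line_φ₂ := fun i j t ht x =>
        hasLineDerivAt_add (l2 i j t ht x) (hasLineDerivAt_potential (hV2 i j) j x)
      time_q := fun t ht x => (tm0 t ht x).congr_deriv ?_
      time_φ := fun t ht x => (((tm0 t ht x).log (hpos t ht x).ne').add_const (V x)).congr_deriv ?_
      time_φ₁ := fun i t ht x =>
        (((hasDerivAt_avg isOpen_Ioo hT hμ₀ (s1 i) (d1 i) (dT1 i) hy ht x).fun_div (tm0 t ht x)
          (hpos t ht x).ne').add_const (partialD i V x)).congr_deriv ?_ }
  · rw [add_sub_cancel_right, score, mul_div_cancel₀ _ (hpos t ht x).ne']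
  · have h := HasDerivAt.log (l0 t ht x i) (by simpa using (hpos t ht x).ne')
    simp only [zero_smul, add_zero] at h
    exact hasLineDerivAt_add h (hasLineDerivAt_potential hV i x)
  · have := (hpos t ht x).ne'
    rw [avg_dt_dens hV hμ₀ hp hT tL hy ht, Finset.mul_sum]
    refine Finset.sum_congr rfl fun j _ => ?_
    simp only [score₂, score]
    field_simp
    ring
  · have := (hpos t ht x).ne'
    rw [avg_dt_dens hV hμ₀ hp hT tL hy ht, Finset.sum_div]
    refine Finset.sum_congr rfl fun j _ => ?_
    simp only [score₂, score]
    field_simp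
    ring
  · have := (hpos t ht x).ne'
    rw [avg_dt_dens hV hμ₀ hp hT tL hy ht, avg_dt_dx_dens hV hμ₀ hp hT tL hy ht, Finset.sum_mul,
      Finset.mul_sum, ← Finset.sum_sub_distrib, Finset.sum_div]
    refine Finset.sum_congr rfl fun j _ => ?_
    simp only [score₃, score₂, score]
    field_simp
    ring

end Marginal

/-! ### Functions with finite moments -/

section Moments

variable {Y : Type*} [MeasurableSpace Y] {ν : Measure Y} {w f g : Y → ℝ}

/-- `f` has finite moments of all orders with respect to the density `w`. -/
def FiniteMoments (ν : Measure Y) (w f : Y → ℝ) : Prop :=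
  AEStronglyMeasurable f ν ∧ ∀ m : ℕ, Integrable (fun y => w y * |f y| ^ m) ν

namespace FiniteMoments

lemma weight (hf : FiniteMoments ν w f) : Integrable w ν := by
  simpa using hf.2 0

lemma integrable (hf : FiniteMoments ν w f) : Integrable (fun y => w y * f y) ν := by
  refine (hf.2 1).mono (hf.weight.1.mul hf.1) (.of_forall fun y => ?_)
  simp

lemma const (hf : FiniteMoments ν w f) (c : ℝ) : FiniteMoments ν w (fun _ => c) :=
  ⟨aestronglyMeasurable_const, fun _ => hf.weight.mul_const _⟩

lemma add (hf : FiniteMoments ν w f) (hg : FiniteMoments ν w g) :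
    FiniteMoments ν w (fun y => f y + g y) := by
  refine ⟨hf.1.add hg.1, fun m => ?_⟩
  refine (((hf.2 m).abs.add (hg.2 m).abs).const_mul (2 ^ (m - 1))).mono'
    (hf.weight.1.mul ((continuous_abs.comp_aestronglyMeasurable (hf.1.add hg.1)).pow m))
    (.of_forall fun y => ?_)
  have h := (pow_le_pow_left₀ (abs_nonneg _) (abs_add_le (f y) (g y)) m).trans
    (add_pow_le (abs_nonneg _) (abs_nonneg _) m)
  rw [Real.norm_eq_abs, abs_mul, abs_of_nonneg (by positivity : 0 ≤ |f y + g y| ^ m)]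
  refine (mul_le_mul_of_nonneg_left h (abs_nonneg _)).trans (le_of_eq ?_)
  simp only [Pi.add_apply, abs_mul, abs_pow, abs_abs]
  ring

lemma mul (hf : FiniteMoments ν w f) (hg : FiniteMoments ν w g) :
    FiniteMoments ν w (fun y => f y * g y) := by
  refine ⟨hf.1.mul hg.1, fun m => ?_⟩
  refine ((hf.2 (2 * m)).abs.add (hg.2 (2 * m)).abs).mono'
    (hf.weight.1.mul ((continuous_abs.comp_aestronglyMeasurable (hf.1.mul hg.1)).pow m))
    (.of_forall fun y => ?_)
  have h : |f y * g y| ^ m ≤ |f y| ^ (2 * m) + |g y| ^ (2 * m) := by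
    rw [abs_mul, mul_pow, mul_comm 2 m, pow_mul, pow_mul]
    nlinarith [sq_nonneg (|f y| ^ m - |g y| ^ m), sq_nonneg (|f y| ^ m), sq_nonneg (|g y| ^ m)]
  rw [Real.norm_eq_abs, abs_mul, abs_of_nonneg (by positivity : 0 ≤ |f y * g y| ^ m)]
  refine (mul_le_mul_of_nonneg_left h (abs_nonneg _)).trans (le_of_eq ?_)
  simp only [Pi.add_apply, abs_mul, abs_pow, abs_abs]
  ring

lemma const_mul (hf : FiniteMoments ν w f) (c : ℝ) : FiniteMoments ν w (fun y => c * f y) :=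
  (hf.const c).mul hf

lemma sub (hf : FiniteMoments ν w f) (hg : FiniteMoments ν w g) :
    FiniteMoments ν w (fun y => f y - g y) := by
  simpa only [neg_one_mul, ← sub_eq_add_neg] using hf.add (hg.const_mul (-1))

lemma pow_two (hf : FiniteMoments ν w f) : FiniteMoments ν w (fun y => f y ^ 2) := by
  simpa only [sq] using hf.mul hf

lemma sum {ι : Type*} [Fintype ι] {h : ι → Y → ℝ} (hw : Integrable w ν)
    (hh : ∀ i, FiniteMoments ν w (h i)) : FiniteMoments ν w (fun y => ∑ i, h i y) := by
  classical
  have h0 : FiniteMoments ν w (fun _ => 0) :=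
    ⟨aestronglyMeasurable_const, fun _ => hw.mul_const _⟩
  induction (Finset.univ : Finset ι) using Finset.induction_on with
  | empty => simpa using h0
  | insert a s ha ih => simpa only [Finset.sum_insert ha] using (hh a).add ih

lemma integral_add (hf : FiniteMoments ν w f) (hg : FiniteMoments ν w g) :
    ∫ y, w y * (f y + g y) ∂ν = ∫ y, w y * f y ∂ν + ∫ y, w y * g y ∂ν := by
  simp only [mul_add]
  exact MeasureTheory.integral_add hf.integrable hg.integrable

lemma integral_sub (hf : FiniteMoments ν w f) (hg : FiniteMoments ν w g) :
    ∫ y, w y * (f y - g y) ∂ν = ∫ y, w y * f y ∂ν - ∫ y, w y * g y ∂ν := by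
  simp only [mul_sub]
  exact MeasureTheory.integral_sub hf.integrable hg.integrable

lemma integral_sum {ι : Type*} [Fintype ι] {h : ι → Y → ℝ}
    (hh : ∀ i, FiniteMoments ν w (h i)) :
    ∫ y, w y * ∑ i, h i y ∂ν = ∑ i, ∫ y, w y * h i y ∂ν := by
  simp only [Finset.mul_sum]
  exact integral_finsetSum _ fun i _ => (hh i).integrable

end FiniteMoments

/-- Once the time derivatives are taken, only integrals at a fixed time remain. Finite moments of
all orders suffice for their algebra and, unlike pointwise bounds, pass from the marginal to the
joint density by Tonelli's theorem. -/
lemma Tame.finiteMoments {Y : Type*} [NormedAddCommGroup Y] [NormedSpace ℝ Y]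
    [FiniteDimensional ℝ Y] [MeasurableSpace Y] [BorelSpace Y] {ν : Measure Y}
    [ν.IsAddHaarMeasure] {T : Set ℝ} {q g : ℝ → Y → ℝ} (hg : Tame T q g)
    (hy : Tame T q (fun _ y => ‖y‖)) {t : ℝ} (ht : t ∈ T) (hqm : AEStronglyMeasurable (q t) ν)
    (hgm : AEStronglyMeasurable (g t) ν) : FiniteMoments ν (q t) (g t) :=
  ⟨hgm, fun m => (hg.abs.pow m).integrable hy ht hqm
    ((continuous_abs.comp_aestronglyMeasurable hgm).pow m)⟩

end Moments

/-! ### The posterior density -/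

/-- The assumptions on the flow. -/
structure IsRapidFlow (V μ₀ : E N → ℝ) (p : ℝ → E N → E N → ℝ) : Prop where
  smooth_potential : ContDiff ℝ ∞ V
  prob : IsProbDensity μ₀
  trans : IsTransitionDensity V p
  decay : RapidlyDecreasing V μ₀ p

namespace IsRapidFlow

variable {V μ₀ : E N → ℝ} {p : ℝ → E N → E N → ℝ} {t : ℝ}

/-- The derivative `∂ᵢ log μ_{0|t}` in the end point. -/
noncomputable def post (μ₀ : E N → ℝ) (p : ℝ → E N → E N → ℝ) (t : ℝ) (i : Fin N)
    (z : E N × E N) : ℝ :=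
  pd (eX i) (logDens p) (t, z) - score μ₀ p i t z.2

/-- The derivative `∂ⱼ ∂ᵢ log μ_{0|t}` in the end point. -/
noncomputable def post₂ (μ₀ : E N → ℝ) (p : ℝ → E N → E N → ℝ) (t : ℝ) (i j : Fin N)
    (z : E N × E N) : ℝ :=
  pd (eX j) (pd (eX i) (logDens p)) (t, z) - score₂ μ₀ p i j t z.2

/-- This window is an open neighbourhood of `t` whose closure stays in the positive times, where the
rapid decay is uniform. -/
lemma mem_window (ht : 0 < t) : t ∈ Ioo (t / 2) (2 * t) := ⟨by linarith, by linarith⟩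

lemma window_pos (t : ℝ) (ht : 0 < t) : Ioo (t / 2) (2 * t) ⊆ Ioi 0 :=
  fun _ hs => (half_pos ht).trans hs.1

lemma densTame (F : IsRapidFlow V μ₀ p) (ht : 0 < t) :
    DensTame (Ioo (t / 2) (2 * t)) μ₀ p (dens p) :=
  densTame_dens (jetTame_logDens F.prob F.trans F.decay (half_pos ht))

lemma densTame_dx (F : IsRapidFlow V μ₀ p) (ht : 0 < t) (i : Fin N) :
    DensTame (Ioo (t / 2) (2 * t)) μ₀ p (pd (eX i) (dens p)) :=
  (F.densTame ht).pd_eX F.trans (window_pos t ht)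
    (jetTame_logDens F.prob F.trans F.decay (half_pos ht)) i

lemma densTame_dx_dx (F : IsRapidFlow V μ₀ p) (ht : 0 < t) (i j : Fin N) :
    DensTame (Ioo (t / 2) (2 * t)) μ₀ p (pd (eX j) (pd (eX i) (dens p))) :=
  (F.densTame_dx ht i).pd_eX F.trans (window_pos t ht)
    (jetTame_logDens F.prob F.trans F.decay (half_pos ht)) j

lemma tame_norm (F : IsRapidFlow V μ₀ p) (ht : 0 < t) :
    Tame (Ioo (t / 2) (2 * t)) (jointZ μ₀ p) (fun _ z => ‖z‖) :=
  tame_norm_jointZ F.prob F.trans F.decay (half_pos ht)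

lemma smooth_dens (F : IsRapidFlow V μ₀ p) : ContDiffOn ℝ ∞ (dens p) (posTime N) :=
  contDiffOn_dens F.trans

lemma marginal_pos (F : IsRapidFlow V μ₀ p) (ht : 0 < t) (x : E N) : 0 < avg μ₀ (dens p) t x :=
  avg_dens_pos (window_pos t ht) F.prob F.trans (F.densTame ht) (F.tame_norm ht) (mem_window ht) x

lemma integrable_avg (F : IsRapidFlow V μ₀ p) (ht : 0 < t) {G : ℝ × E N × E N → ℝ}
    (sG : ContDiffOn ℝ ∞ G (posTime N)) (hG : DensTame (Ioo (t / 2) (2 * t)) μ₀ p G) (x : E N) :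
    Integrable (fun x₀ => μ₀ x₀ * G (t, x₀, x)) :=
  hG.integrable (window_pos t ht) F.prob sG (F.tame_norm ht) (mem_window ht) x

lemma joint_mul_dx_logDens (F : IsRapidFlow V μ₀ p) (ht : 0 < t) (i : Fin N) (x₀ x : E N) :
    jointZ μ₀ p t (x₀, x) * pd (eX i) (logDens p) (t, x₀, x) =
      μ₀ x₀ * pd (eX i) (dens p) (t, x₀, x) := by
  rw [pd_dens F.trans _ (mem_posTime ht _), jointZ]
  ring

lemma integrable_joint_mul_post (F : IsRapidFlow V μ₀ p) (ht : 0 < t) (i : Fin N) (x : E N) :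
    Integrable (fun x₀ => jointZ μ₀ p t (x₀, x) * post μ₀ p t i (x₀, x)) := by
  have h1 := F.integrable_avg ht (contDiffOn_pd F.smooth_dens (eX i)) (F.densTame_dx ht i) x
  have h0 := F.integrable_avg ht F.smooth_dens (F.densTame ht) x
  refine (h1.sub (h0.mul_const (score μ₀ p i t x))).congr (.of_forall fun x₀ => ?_)
  simp only [Pi.sub_apply, post, mul_sub, F.joint_mul_dx_logDens ht]
  rfl

/-- The posterior score has mean zero. -/
lemma integral_joint_mul_post (F : IsRapidFlow V μ₀ p) (ht : 0 < t) (i : Fin N) (x : E N) :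
    ∫ x₀, jointZ μ₀ p t (x₀, x) * post μ₀ p t i (x₀, x) = 0 := by
  have h1 := F.integrable_avg ht (contDiffOn_pd F.smooth_dens (eX i)) (F.densTame_dx ht i) x
  have h0 := F.integrable_avg ht F.smooth_dens (F.densTame ht) x
  have : ∀ x₀, jointZ μ₀ p t (x₀, x) * post μ₀ p t i (x₀, x) =
      μ₀ x₀ * pd (eX i) (dens p) (t, x₀, x) -
        μ₀ x₀ * dens p (t, x₀, x) * score μ₀ p i t x := fun x₀ => by
    simp only [post, mul_sub, F.joint_mul_dx_logDens ht]
    rfl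
  simp only [this]
  rw [integral_sub h1 (h0.mul_const _), integral_mul_const]
  change avg μ₀ (pd (eX i) (dens p)) t x - avg μ₀ (dens p) t x * _ = 0
  rw [score, mul_div_cancel₀ _ (F.marginal_pos ht x).ne', sub_self]

/-- The posterior mean of `∂ⱼ ∂ᵢ log μ_{0|t} + ∂ᵢ log μ_{0|t} ∂ⱼ log μ_{0|t}` vanishes. -/
lemma integral_joint_mul_post₂ (F : IsRapidFlow V μ₀ p) (ht : 0 < t) (i j : Fin N) (x : E N) :
    ∫ x₀, jointZ μ₀ p t (x₀, x) *
      (post₂ μ₀ p t i j (x₀, x) + post μ₀ p t i (x₀, x) * post μ₀ p t j (x₀, x)) = 0 := by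
  have sL := contDiffOn_logDens F.trans
  have h2 := F.integrable_avg ht (contDiffOn_pd (contDiffOn_pd F.smooth_dens (eX i)) (eX j))
    (F.densTame_dx_dx ht i j) x
  have h0 := F.integrable_avg ht F.smooth_dens (F.densTame ht) x
  have hi := F.integrable_joint_mul_post ht i x
  have hj := F.integrable_joint_mul_post ht j x
  -- With `ℓ = log p`, the combination `p (∂ⱼ∂ᵢℓ + ∂ᵢℓ ∂ⱼℓ)` is `∂ⱼ∂ᵢp`. Writing the remaining `∂ᵢℓ`
  -- as `post` plus `score` leaves multiples of the joint density and of the mean-zero terms.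
  have : ∀ x₀, jointZ μ₀ p t (x₀, x) *
      (post₂ μ₀ p t i j (x₀, x) + post μ₀ p t i (x₀, x) * post μ₀ p t j (x₀, x)) =
      μ₀ x₀ * pd (eX j) (pd (eX i) (dens p)) (t, x₀, x) +
        μ₀ x₀ * dens p (t, x₀, x) *
          -(score₂ μ₀ p i j t x + score μ₀ p i t x * score μ₀ p j t x) +
        jointZ μ₀ p t (x₀, x) * post μ₀ p t i (x₀, x) * -score μ₀ p j t x +
        jointZ μ₀ p t (x₀, x) * post μ₀ p t j (x₀, x) * -score μ₀ p i t x := fun x₀ => by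
    rw [pd_dens_mul F.trans (contDiffOn_pd sL _) (fun w hw => pd_dens F.trans _ hw) _
      (mem_posTime ht _)]
    simp only [post, post₂, jointZ]
    ring
  simp only [this]
  rw [integral_add ((h2.fun_add (h0.mul_const _)).fun_add (hi.mul_const _)) (hj.mul_const _),
    integral_add (h2.fun_add (h0.mul_const _)) (hi.mul_const _), integral_add h2 (h0.mul_const _),
    integral_mul_const, integral_mul_const, integral_mul_const, F.integral_joint_mul_post ht,
    F.integral_joint_mul_post ht]
  change avg μ₀ (pd (eX j) (pd (eX i) (dens p))) t x + avg μ₀ (dens p) t x * _ + _ + _ = 0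
  rw [score₂, sub_add_cancel, mul_neg, mul_div_cancel₀ _ (F.marginal_pos ht x).ne']
  ring

/-- By Tonelli's theorem: integrating out `x₀` turns the joint density into the marginal and leaves
`|h x|^m` alone. -/
lemma finiteMoments_snd (F : IsRapidFlow V μ₀ p) (ht : 0 < t) {h : E N → ℝ}
    (hh : FiniteMoments volume (avg μ₀ (dens p) t) h) :
    FiniteMoments volume (jointZ μ₀ p t) (fun z => h z.2) := by
  have hm : AEStronglyMeasurable (fun z : E N × E N => h z.2) volume := hh.1.comp_snd
  refine ⟨hm, fun m => ?_⟩
  have hmm : AEStronglyMeasurable (fun z : E N × E N => jointZ μ₀ p t z * |h z.2| ^ m) volume :=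
    (measurable_jointZ F.prob F.trans ht).aestronglyMeasurable.mul
      ((continuous_abs.comp_aestronglyMeasurable hm).pow m)
  have h0 := F.integrable_avg ht F.smooth_dens (F.densTame ht)
  refine (integrable_prod_iff' hmm).2 ⟨.of_forall fun x => (h0 x).mul_const (|h x| ^ m), ?_⟩
  refine (hh.2 m).congr (.of_forall fun x => ?_)
  simp only [norm_mul, Real.norm_eq_abs, abs_pow, abs_abs, integral_mul_const]
  congr 1
  refine integral_congr_ae (.of_forall fun x₀ => ?_)
  exact (abs_of_nonneg (jointZ_nonneg F.prob F.trans ht (x₀, x))).symm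

lemma integral_joint_snd (F : IsRapidFlow V μ₀ p) (ht : 0 < t) {h : E N → ℝ}
    (hh : FiniteMoments volume (avg μ₀ (dens p) t) h) :
    ∫ z, jointZ μ₀ p t z * h z.2 = ∫ x, avg μ₀ (dens p) t x * h x := by
  refine (integral_prod_symm _ (F.finiteMoments_snd ht hh).integrable).trans ?_
  refine integral_congr_ae (.of_forall fun x => ?_)
  exact integral_mul_const (h x) fun x₀ => jointZ μ₀ p t (x₀, x)

/-- Functions of posterior mean zero are orthogonal to functions of the end point. -/
lemma integral_joint_mul_snd_eq_zero (F : IsRapidFlow V μ₀ p) (ht : 0 < t) {h : E N → ℝ}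
    {f : E N × E N → ℝ} (hf : FiniteMoments volume (jointZ μ₀ p t) f)
    (hf0 : ∀ x, ∫ x₀, jointZ μ₀ p t (x₀, x) * f (x₀, x) = 0)
    (hh : FiniteMoments volume (avg μ₀ (dens p) t) h) :
    ∫ z, jointZ μ₀ p t z * (f z * h z.2) = 0 := by
  refine (integral_prod_symm _ (hf.mul (F.finiteMoments_snd ht hh)).integrable).trans ?_
  refine integral_eq_zero_of_ae (.of_forall fun x => ?_)
  simp only [← mul_assoc, integral_mul_const, hf0, zero_mul, Pi.zero_apply]

end IsRapidFlow

/-! ### Rules for partial derivatives, and the algebra of the difference of dissipations -/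

lemma partialD_eq_of_hasLineDerivAt {f : E N → ℝ} {x : E N} {c : ℝ} {i : Fin N}
    (hf : DifferentiableAt ℝ f x) (h : HasLineDerivAt ℝ f c x (EuclideanSpace.single i 1)) :
    partialD i f x = c :=
  (hf.hasFDerivAt.hasLineDerivAt _).unique h

lemma partialD_add {f g : E N → ℝ} {x : E N} (hf : DifferentiableAt ℝ f x)
    (hg : DifferentiableAt ℝ g x) (i : Fin N) :
    partialD i (fun y => f y + g y) x = partialD i f x + partialD i g x := by
  rw [partialD, fderiv_fun_add hf hg]
  rfl

lemma partialD_sub {f g : E N → ℝ} {x : E N} (hf : DifferentiableAt ℝ f x)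
    (hg : DifferentiableAt ℝ g x) (i : Fin N) :
    partialD i (fun y => f y - g y) x = partialD i f x - partialD i g x := by
  rw [partialD, fderiv_fun_sub hf hg]
  rfl

lemma partialD_const_add (f : E N → ℝ) (x : E N) (c : ℝ) (i : Fin N) :
    partialD i (fun y => c + f y) x = partialD i f x := by
  rw [partialD, fderiv_const_add]
  rfl

lemma partialD_const_mul {f : E N → ℝ} {x : E N} (hf : DifferentiableAt ℝ f x) (c : ℝ)
    (i : Fin N) : partialD i (fun y => c * f y) x = c * partialD i f x := by
  rw [partialD, fderiv_const_mul hf]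
  rfl

lemma norm_gradient_sq (f : E N → ℝ) (x : E N) : ‖∇ f x‖ ^ 2 = ∑ i, partialD i f x ^ 2 := by
  rw [EuclideanSpace.real_norm_sq_eq]
  simp only [gradient_apply]

instance isAddHaarMeasure_volume_prod : (volume : Measure (E N × E N)).IsAddHaarMeasure :=
  inferInstanceAs ((volume : Measure (E N)).prod volume).IsAddHaarMeasure

/-- Here `r`, `R` are the gradient and Hessian of `log μ_{0|t}`, `s = ∇(log μₜ + V)`, `S = ∇² log
μₜ` and `W = ∇²V`. Of the term `2⟨R, S + W⟩`, one half of the `W` part goes into `∇² log γₜ = S +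
W/2`; the other half joins `rᵀWr` to form `⟨R + r rᵀ, W⟩`. That term and the last one have posterior
mean zero. Writing `W i j + W j i` avoids assuming `W` symmetric. -/
lemma dissipation_difference_identity (r s : Fin N → ℝ) (R S W : Fin N → Fin N → ℝ) :
    ∑ i, ∑ j, ((R i j + S i j + W i j) ^ 2 + (r i + s i) * W i j * (r j + s j)) -
      ∑ i, ∑ j, ((S i j + W i j) ^ 2 + s i * W i j * s j) =
    (∑ i, ∑ j, R i j ^ 2) + 2 * (∑ i, ∑ j, R i j * (2⁻¹ * W i j + S i j)) +
      (∑ i, ∑ j, (R i j + r i * r j) * W i j) + ∑ i, r i * ∑ j, (W i j + W j i) * s j := by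
  have h : ∑ i, r i * ∑ j, (W i j + W j i) * s j =
      ∑ i, ∑ j, (r i * W i j * s j + s i * W i j * r j) := by
    simp only [Finset.sum_add_distrib, Finset.mul_sum, add_mul, mul_add]
    rw [Finset.sum_comm (f := fun i j => r i * (W j i * s j))]
    simp only [← Finset.sum_add_distrib]
    exact Finset.sum_congr rfl fun i _ => Finset.sum_congr rfl fun j _ => by ring
  rw [h]
  simp only [Finset.mul_sum, ← Finset.sum_add_distrib, ← Finset.sum_sub_distrib]
  exact Finset.sum_congr rfl fun i _ => Finset.sum_congr rfl fun j _ => by ring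

namespace IsRapidFlow

variable {V μ₀ : E N → ℝ} {p : ℝ → E N → E N → ℝ} {t : ℝ}

/-! ### Derivatives of the logarithms of the densities -/

lemma differentiableAt_avg_dens (F : IsRapidFlow V μ₀ p) (ht : 0 < t) (x : E N) :
    DifferentiableAt ℝ (avg μ₀ (dens p) t) x :=
  (hasFDerivAt_avg (window_pos t ht) F.prob F.smooth_dens (F.densTame ht) (F.densTame_dx ht)
    (F.tame_norm ht) (mem_window ht) x).1

lemma differentiableAt_log_avg (F : IsRapidFlow V μ₀ p) (ht : 0 < t) (x : E N) :
    DifferentiableAt ℝ (fun y => Real.log (avg μ₀ (dens p) t y)) x :=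
  (F.differentiableAt_avg_dens ht x).log (F.marginal_pos ht x).ne'

lemma partialD_log_avg (F : IsRapidFlow V μ₀ p) (ht : 0 < t) (i : Fin N) :
    partialD i (fun y => Real.log (avg μ₀ (dens p) t y)) = score μ₀ p i t := by
  funext x
  have h := hasFDerivAt_avg (window_pos t ht) F.prob F.smooth_dens (F.densTame ht)
    (F.densTame_dx ht) (F.tame_norm ht) (mem_window ht) x
  have hl := (h.1.hasFDerivAt.log (F.marginal_pos ht x).ne').fderiv
  have h2 := h.2 i
  rw [partialD] at h2 ⊢
  rw [hl, score, ← h2, div_eq_inv_mul]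
  rfl

lemma differentiableAt_score (F : IsRapidFlow V μ₀ p) (ht : 0 < t) (i : Fin N) (x : E N) :
    DifferentiableAt ℝ (score μ₀ p i t) x := by
  have h := (hasFDerivAt_avg (window_pos t ht) F.prob (contDiffOn_pd F.smooth_dens (eX i))
    (F.densTame_dx ht i) (F.densTame_dx_dx ht i) (F.tame_norm ht) (mem_window ht) x).1
  change DifferentiableAt ℝ (fun y => avg μ₀ (pd (eX i) (dens p)) t y / avg μ₀ (dens p) t y) x
  simp only [div_eq_mul_inv]
  exact h.fun_mul ((F.differentiableAt_avg_dens ht x).fun_inv (F.marginal_pos ht x).ne')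

lemma partialD_score (F : IsRapidFlow V μ₀ p) (ht : 0 < t) (i j : Fin N) :
    partialD j (score μ₀ p i t) = score₂ μ₀ p i j t := by
  funext x
  refine partialD_eq_of_hasLineDerivAt (F.differentiableAt_score ht i x) ?_
  exact hasLineDerivAt_div
    (hasLineDerivAt_avg (window_pos t ht) F.prob (contDiffOn_pd F.smooth_dens (eX i))
      (F.densTame_dx ht i) (F.densTame_dx_dx ht i) (F.tame_norm ht) (mem_window ht) x j)
    (hasLineDerivAt_avg (window_pos t ht) F.prob F.smooth_dens (F.densTame ht) (F.densTame_dx ht)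
      (F.tame_norm ht) (mem_window ht) x j) (F.marginal_pos ht x).ne'

/-- The term `log (μ₀ x₀)` does not depend on the end point, so it disappears from all derivatives.
-/
lemma log_posterior (F : IsRapidFlow V μ₀ p) (ht : 0 < t) {x₀ : E N} (h0 : μ₀ x₀ ≠ 0) :
    (fun y => Real.log (posterior μ₀ (p t) x₀ y)) = fun y =>
      Real.log (μ₀ x₀) + (logDens p (t, x₀, y) - Real.log (avg μ₀ (dens p) t y)) := by
  funext y
  have h1 := (F.trans.pos t ht x₀ y).ne'
  rw [posterior, joint]
  change Real.log (μ₀ x₀ * p t x₀ y / avg μ₀ (dens p) t y) = _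
  rw [Real.log_div (mul_ne_zero h0 h1) (F.marginal_pos ht y).ne', Real.log_mul h0 h1, add_sub_assoc]
  rfl

lemma partialD_log_posterior (F : IsRapidFlow V μ₀ p) (ht : 0 < t) {x₀ : E N} (h0 : μ₀ x₀ ≠ 0)
    (i : Fin N) : partialD i (fun y => Real.log (posterior μ₀ (p t) x₀ y)) =
      fun y => post μ₀ p t i (x₀, y) := by
  funext y
  have sL := contDiffOn_logDens F.trans
  rw [F.log_posterior ht h0, partialD_const_add,
    partialD_sub (hasFDerivAt_slice sL ht x₀ y).differentiableAt (F.differentiableAt_log_avg ht y),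
    partialD_slice sL ht, F.partialD_log_avg ht, post]

lemma hessLogPosterior_apply (F : IsRapidFlow V μ₀ p) (ht : 0 < t) {x₀ : E N} (h0 : μ₀ x₀ ≠ 0)
    (x : E N) (i j : Fin N) :
    hessLogPosterior μ₀ (p t) x₀ x i j = post₂ μ₀ p t j i (x₀, x) := by
  change partialD i (partialD j fun y => Real.log (posterior μ₀ (p t) x₀ y)) x = _
  have sL := contDiffOn_pd (contDiffOn_logDens F.trans) (eX j)
  rw [F.partialD_log_posterior ht h0]
  simp only [post]
  rw [partialD_sub (hasFDerivAt_slice sL ht x₀ x).differentiableAt (F.differentiableAt_score ht j x),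
    partialD_slice sL ht, F.partialD_score ht, post₂]

lemma gradLogPosterior_apply (F : IsRapidFlow V μ₀ p) (ht : 0 < t) {x₀ : E N} (h0 : μ₀ x₀ ≠ 0)
    (x : E N) (i : Fin N) : gradLogPosterior μ₀ (p t) x₀ x i = post μ₀ p t i (x₀, x) := by
  rw [gradLogPosterior, gradient_apply, F.partialD_log_posterior ht h0]

lemma hessian_logGamma_apply (F : IsRapidFlow V μ₀ p) (ht : 0 < t) (x : E N) (i j : Fin N) :
    hessian (logGamma V μ₀ (p t)) x i j =
      2⁻¹ * partialD i (partialD j V) x + score₂ μ₀ p j i t x := by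
  change partialD i (partialD j (logGamma V μ₀ (p t))) x = _
  have hV := F.smooth_potential
  have dV : Differentiable ℝ V := hV.differentiable (by simp)
  have dV1 : Differentiable ℝ (partialD j V) := (contDiff_partialD hV j).differentiable (by simp)
  have h : logGamma V μ₀ (p t) = fun y => 2⁻¹ * V y + Real.log (avg μ₀ (dens p) t y) := by
    funext y
    change Real.log (Real.exp (V y / 2) * avg μ₀ (dens p) t y) = _
    rw [Real.log_mul (Real.exp_pos _).ne' (F.marginal_pos ht y).ne', Real.log_exp]
    ring
  have h1 : partialD j (logGamma V μ₀ (p t)) =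
      fun y => 2⁻¹ * partialD j V y + score μ₀ p j t y := by
    funext y
    rw [h, partialD_add ((dV y).const_mul _) (F.differentiableAt_log_avg ht y),
      partialD_const_mul (dV y), F.partialD_log_avg ht]
  rw [h1, partialD_add ((dV1 x).const_mul _) (F.differentiableAt_score ht j x),
    partialD_const_mul (dV1 x), F.partialD_score ht]

lemma relFisherIntegrand_marginal (F : IsRapidFlow V μ₀ p) (ht : 0 < t) :
    relFisherIntegrand V (marginal μ₀ (p t)) = fun x =>
      avg μ₀ (dens p) t x * ∑ i, (score μ₀ p i t x + partialD i V x) ^ 2 := by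
  funext x
  have h : (fun y => Real.log (marginal μ₀ (p t) y / refDensity V y)) =
      fun y => Real.log (avg μ₀ (dens p) t y) + V y := by
    funext y
    change Real.log (avg μ₀ (dens p) t y / Real.exp (-V y)) = _
    rw [Real.log_div (F.marginal_pos ht y).ne' (Real.exp_pos _).ne', Real.log_exp, sub_neg_eq_add]
  rw [relFisherIntegrand, h, norm_gradient_sq]
  simp only [partialD_add (F.differentiableAt_log_avg ht x)
    (F.smooth_potential.differentiable (by simp) x), F.partialD_log_avg ht]
  rfl

lemma relFisherIntegrand_trans (F : IsRapidFlow V μ₀ p) (ht : 0 < t) (z : E N × E N) :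
    μ₀ z.1 * relFisherIntegrand V (p t z.1) z.2 =
      jointZ μ₀ p t z * ∑ i, (pd (eX i) (logDens p) (t, z) + partialD i V z.2) ^ 2 := by
  have sL := contDiffOn_logDens F.trans
  have h : (fun y => Real.log (p t z.1 y / refDensity V y)) =
      fun y => logDens p (t, z.1, y) + V y := by
    funext y
    rw [refDensity, Real.log_div (F.trans.pos t ht z.1 y).ne' (Real.exp_pos _).ne', Real.log_exp,
      sub_neg_eq_add]
    rfl
  rw [relFisherIntegrand, h, norm_gradient_sq, jointZ, ← mul_assoc]
  simp only [partialD_add (hasFDerivAt_slice sL ht z.1 z.2).differentiableAt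
    (F.smooth_potential.differentiable (by simp) z.2), partialD_slice sL ht]
  rfl

lemma backwardFisherTwoIntegrand_eq (F : IsRapidFlow V μ₀ p) (ht : 0 < t) :
    backwardFisherTwoIntegrand μ₀ (p t) = fun z =>
      jointZ μ₀ p t z * ∑ i, ∑ j, post₂ μ₀ p t i j z ^ 2 := by
  funext z
  -- Where `μ₀` vanishes, the joint density makes both sides zero, whatever the logarithm of the
  -- posterior means there.
  rcases eq_or_ne (μ₀ z.1) 0 with h0 | h0
  · simp [backwardFisherTwoIntegrand, joint, jointZ, h0]
  -- The Hessian entry `i j` is `∂ᵢ∂ⱼ`, whereas `post₂ i j` is `∂ⱼ∂ᵢ`; exchanging the sums matches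
  -- them without appeal to symmetry.
  · rw [Finset.sum_comm]
    simp only [backwardFisherTwoIntegrand, hsInner, F.hessLogPosterior_apply ht h0, ← sq]
    rfl

lemma crossHessIntegrand_eq (F : IsRapidFlow V μ₀ p) (ht : 0 < t) :
    crossHessIntegrand V μ₀ (p t) = fun z =>
      jointZ μ₀ p t z * ∑ i, ∑ j, post₂ μ₀ p t i j z *
        (2⁻¹ * partialD j (partialD i V) z.2 + score₂ μ₀ p i j t z.2) := by
  funext z
  rcases eq_or_ne (μ₀ z.1) 0 with h0 | h0
  · simp [crossHessIntegrand, joint, jointZ, h0]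
  · rw [Finset.sum_comm]
    simp only [crossHessIntegrand, hsInner, F.hessLogPosterior_apply ht h0,
      F.hessian_logGamma_apply ht, mul_comm (post₂ μ₀ p t _ _ z)]
    rfl

lemma quadFormIntegrand_eq (F : IsRapidFlow V μ₀ p) (ht : 0 < t) :
    quadFormIntegrand V μ₀ (p t) = fun z =>
      jointZ μ₀ p t z * ∑ i, ∑ j, post μ₀ p t i z * post μ₀ p t j z *
        (2⁻¹ * partialD j (partialD i V) z.2 + score₂ μ₀ p i j t z.2) := by
  funext z
  rcases eq_or_ne (μ₀ z.1) 0 with h0 | h0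
  · simp [quadFormIntegrand, joint, jointZ, h0]
  · rw [Finset.sum_comm]
    simp only [quadFormIntegrand, dotProduct, Matrix.mulVec, F.gradLogPosterior_apply ht h0,
      F.hessian_logGamma_apply ht, Finset.mul_sum]
    refine Finset.sum_congr rfl fun i _ => Finset.sum_congr rfl fun j _ => ?_
    simp only [joint, jointZ, dens]
    ring

/-! ### Finite moments -/

lemma moments_logDens (F : IsRapidFlow V μ₀ p) (ht : 0 < t) :
    FiniteMoments volume (jointZ μ₀ p t) (fun z => logDens p (t, z)) :=
  (jetTame_logDens F.prob F.trans F.decay (half_pos ht)).tame.finiteMoments (F.tame_norm ht)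
    (mem_window ht) (measurable_jointZ F.prob F.trans ht).aestronglyMeasurable
    (aestronglyMeasurable_slice (contDiffOn_logDens F.trans) ht)

lemma moments_dx_logDens (F : IsRapidFlow V μ₀ p) (ht : 0 < t) (i : Fin N) :
    FiniteMoments volume (jointZ μ₀ p t) (fun z => pd (eX i) (logDens p) (t, z)) :=
  ((jetTame_logDens F.prob F.trans F.decay (half_pos ht)).pd (window_pos t ht)
    (contDiffOn_logDens F.trans) i).tame.finiteMoments (F.tame_norm ht)
    (mem_window ht) (measurable_jointZ F.prob F.trans ht).aestronglyMeasurable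
    (aestronglyMeasurable_slice (contDiffOn_pd (contDiffOn_logDens F.trans) _) ht)

lemma moments_dx_dx_logDens (F : IsRapidFlow V μ₀ p) (ht : 0 < t) (i j : Fin N) :
    FiniteMoments volume (jointZ μ₀ p t) (fun z => pd (eX j) (pd (eX i) (logDens p)) (t, z)) :=
  (((jetTame_logDens F.prob F.trans F.decay (half_pos ht)).pd (window_pos t ht)
    (contDiffOn_logDens F.trans) i).pd (window_pos t ht)
    (contDiffOn_pd (contDiffOn_logDens F.trans) _) j).tame.finiteMoments (F.tame_norm ht)
    (mem_window ht) (measurable_jointZ F.prob F.trans ht).aestronglyMeasurable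
    (aestronglyMeasurable_slice (contDiffOn_pd (contDiffOn_pd (contDiffOn_logDens F.trans) _) _) ht)

lemma moments_marginal (F : IsRapidFlow V μ₀ p) (ht : 0 < t) {g : ℝ → E N → ℝ}
    (hg : Tame (Ioo (t / 2) (2 * t)) (avg μ₀ (dens p)) g)
    (hgm : AEStronglyMeasurable (g t) volume) :
    FiniteMoments volume (avg μ₀ (dens p) t) (g t) :=
  have S := logFPSystem_marginal (b := 2 * t) F.smooth_potential F.prob F.trans F.decay
    (half_pos ht)
  hg.finiteMoments S.tame_norm (mem_window ht) (S.meas_q t (mem_window ht)) hgm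

lemma moments_potential (F : IsRapidFlow V μ₀ p) (ht : 0 < t) :
    FiniteMoments volume (avg μ₀ (dens p) t) V :=
  F.moments_marginal ht (tame_avg_endPoint (F.tame_norm ht)
    (jetTame_potential F.prob F.trans F.decay (half_pos ht)).tame)
    F.smooth_potential.continuous.aestronglyMeasurable

lemma moments_partialD (F : IsRapidFlow V μ₀ p) (ht : 0 < t) (i : Fin N) :
    FiniteMoments volume (avg μ₀ (dens p) t) (partialD i V) :=
  have S := logFPSystem_marginal (b := 2 * t) F.smooth_potential F.prob F.trans F.decay
    (half_pos ht)
  F.moments_marginal ht (S.tame_U₁ i) (S.meas_U₁ i)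

lemma moments_partialD_partialD (F : IsRapidFlow V μ₀ p) (ht : 0 < t) (i j : Fin N) :
    FiniteMoments volume (avg μ₀ (dens p) t) (partialD j (partialD i V)) :=
  have S := logFPSystem_marginal (b := 2 * t) F.smooth_potential F.prob F.trans F.decay
    (half_pos ht)
  F.moments_marginal ht (S.tame_U₂ i j) (S.meas_U₂ i j)

lemma moments_log_avg (F : IsRapidFlow V μ₀ p) (ht : 0 < t) :
    FiniteMoments volume (avg μ₀ (dens p) t) (fun x => Real.log (avg μ₀ (dens p) t x)) :=
  F.moments_marginal ht (g := fun t x => Real.log (avg μ₀ (dens p) t x))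
    (tame_log_avg (window_pos t ht) F.prob F.trans (F.tame_norm ht) (F.densTame ht))
    (measurable_avg F.smooth_dens F.prob ht).measurable.log.aestronglyMeasurable

lemma moments_score (F : IsRapidFlow V μ₀ p) (ht : 0 < t) (i : Fin N) :
    FiniteMoments volume (avg μ₀ (dens p) t) (score μ₀ p i t) := by
  have S := logFPSystem_marginal (b := 2 * t) F.smooth_potential F.prob F.trans F.decay
    (half_pos ht)
  -- The system of the marginal controls `∂ᵢ(log μₜ + V)`; subtracting `∂ᵢV` isolates the score.
  simpa only [add_sub_cancel_right] using
    (F.moments_marginal ht (S.tame_φ₁ i) (S.meas_φ₁ i t (mem_window ht))).sub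
      (F.moments_partialD ht i)

lemma moments_score₂ (F : IsRapidFlow V μ₀ p) (ht : 0 < t) (i j : Fin N) :
    FiniteMoments volume (avg μ₀ (dens p) t) (score₂ μ₀ p i j t) := by
  have S := logFPSystem_marginal (b := 2 * t) F.smooth_potential F.prob F.trans F.decay
    (half_pos ht)
  simpa only [add_sub_cancel_right] using
    (F.moments_marginal ht (S.tame_φ₂ i j) (S.meas_φ₂ i j t (mem_window ht))).sub
      (F.moments_partialD_partialD ht i j)

lemma moments_post (F : IsRapidFlow V μ₀ p) (ht : 0 < t) (i : Fin N) :
    FiniteMoments volume (jointZ μ₀ p t) (post μ₀ p t i) :=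
  (F.moments_dx_logDens ht i).sub (F.finiteMoments_snd ht (F.moments_score ht i))

lemma moments_post₂ (F : IsRapidFlow V μ₀ p) (ht : 0 < t) (i j : Fin N) :
    FiniteMoments volume (jointZ μ₀ p t) (post₂ μ₀ p t i j) :=
  (F.moments_dx_dx_logDens ht i j).sub (F.finiteMoments_snd ht (F.moments_score₂ ht i j))

/-- The Hessian of `log γₜ` has finite moments. -/
lemma moments_hessLogGamma (F : IsRapidFlow V μ₀ p) (ht : 0 < t) (i j : Fin N) :
    FiniteMoments volume (avg μ₀ (dens p) t)
      (fun x => 2⁻¹ * partialD j (partialD i V) x + score₂ μ₀ p i j t x) :=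
  ((F.moments_partialD_partialD ht i j).const_mul _).add (F.moments_score₂ ht i j)

/-! ### Mutual information and mutual Fisher information as integrals -/

/-- Adding `V` to both logarithms changes nothing, because `X_t` has density `μₜ` under the joint
law. It turns the entropies into relative entropies, whose dissipation is known. -/
lemma mutualInfo_eq (F : IsRapidFlow V μ₀ p) (ht : 0 < t) :
    mutualInfo μ₀ (p t) = (∫ z, jointZ μ₀ p t z * (logDens p (t, z) + V z.2)) -
      ∫ x, avg μ₀ (dens p) t x * (Real.log (avg μ₀ (dens p) t x) + V x) := by
  rw [(F.moments_logDens ht).integral_add (F.finiteMoments_snd ht (F.moments_potential ht)),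
    (F.moments_log_avg ht).integral_add (F.moments_potential ht),
    F.integral_joint_snd ht (F.moments_potential ht)]
  have h1 : condVersion entropy μ₀ (p t) = -∫ z, jointZ μ₀ p t z * logDens p (t, z) := by
    have h := integral_prod (fun z => jointZ μ₀ p t z * logDens p (t, z))
      (F.moments_logDens ht).integrable
    change _ = -∫ z, jointZ μ₀ p t z * logDens p (t, z) ∂(volume.prod volume)
    rw [h, condVersion, ← integral_neg]
    refine integral_congr_ae (.of_forall fun x₀ => ?_)
    simp only [entropy, mul_neg, neg_inj, jointZ, mul_assoc, integral_const_mul]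
    rfl
  have h2 : entropy (marginal μ₀ (p t)) =
      -∫ x, avg μ₀ (dens p) t x * Real.log (avg μ₀ (dens p) t x) := rfl
  rw [mutualInfo, h1, h2]
  ring

lemma moments_relFisher_joint (F : IsRapidFlow V μ₀ p) (ht : 0 < t) :
    FiniteMoments volume (jointZ μ₀ p t)
      (fun z => ∑ i, (pd (eX i) (logDens p) (t, z) + partialD i V z.2) ^ 2) :=
  .sum (F.moments_logDens ht).weight fun i => ((F.moments_dx_logDens ht i).add
    (F.finiteMoments_snd ht (F.moments_partialD ht i))).pow_two

lemma moments_relFisher_marginal (F : IsRapidFlow V μ₀ p) (ht : 0 < t) :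
    FiniteMoments volume (avg μ₀ (dens p) t)
      (fun x => ∑ i, (score μ₀ p i t x + partialD i V x) ^ 2) :=
  .sum (F.moments_potential ht).weight fun i => ((F.moments_score ht i).add
    (F.moments_partialD ht i)).pow_two

lemma mutualRelFisher_eq (F : IsRapidFlow V μ₀ p) (ht : 0 < t) :
    mutualRelFisher V μ₀ (p t) =
      (∫ z, jointZ μ₀ p t z * ∑ i, (pd (eX i) (logDens p) (t, z) + partialD i V z.2) ^ 2) -
      ∫ x, avg μ₀ (dens p) t x * ∑ i, (score μ₀ p i t x + partialD i V x) ^ 2 := by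
  rw [mutualRelFisher, relFisher, F.relFisherIntegrand_marginal ht]
  congr 1
  simp only [← F.relFisherIntegrand_trans ht]
  have hi : Integrable (fun z : E N × E N => μ₀ z.1 * relFisherIntegrand V (p t z.1) z.2)
      (volume.prod volume) := by
    simp only [F.relFisherIntegrand_trans ht]
    exact (F.moments_relFisher_joint ht).integrable
  refine Eq.trans ?_ (integral_prod _ hi).symm
  simp only [integral_const_mul]
  rfl

/-- The mutual Fisher information is the posterior Fisher information. -/
lemma mutualRelFisher_eq_post (F : IsRapidFlow V μ₀ p) (ht : 0 < t) :
    mutualRelFisher V μ₀ (p t) = ∫ z, jointZ μ₀ p t z * ∑ i, post μ₀ p t i z ^ 2 := by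
  have hS := fun i => (F.moments_score ht i).add (F.moments_partialD ht i)
  have hP2 := FiniteMoments.sum (F.moments_logDens ht).weight fun i =>
    (F.moments_post ht i).pow_two
  have hX := fun i => ((F.moments_post ht i).mul (F.finiteMoments_snd ht (hS i))).const_mul 2
  rw [F.mutualRelFisher_eq ht, ← F.integral_joint_snd ht (F.moments_relFisher_marginal ht),
    ← (F.moments_relFisher_joint ht).integral_sub
      (F.finiteMoments_snd ht (F.moments_relFisher_marginal ht))]
  -- In `|r + s|² - |s|² = |r|² + 2 r·s`, the cross term vanishes because `s` depends on the end
  -- point only.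
  have hz : ∫ z, jointZ μ₀ p t z * ∑ i, 2 * (post μ₀ p t i z *
      (score μ₀ p i t z.2 + partialD i V z.2)) = 0 := by
    rw [FiniteMoments.integral_sum hX]
    refine Finset.sum_eq_zero fun i _ => ?_
    simp only [mul_left_comm _ (2 : ℝ), integral_const_mul]
    rw [F.integral_joint_mul_snd_eq_zero ht (F.moments_post ht i)
      (F.integral_joint_mul_post ht i) (hS i), mul_zero]
  rw [← add_zero (∫ z, jointZ μ₀ p t z * ∑ i, post μ₀ p t i z ^ 2), ← hz,
    ← hP2.integral_add (.sum (F.moments_logDens ht).weight hX)]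
  refine integral_congr_ae (.of_forall fun z => ?_)
  simp only [← Finset.sum_sub_distrib, ← Finset.sum_add_distrib]
  congr 1
  refine Finset.sum_congr rfl fun i _ => ?_
  rw [post]
  ring

lemma mutualRelFisher_nonneg (F : IsRapidFlow V μ₀ p) (ht : 0 < t) :
    0 ≤ mutualRelFisher V μ₀ (p t) := by
  rw [F.mutualRelFisher_eq_post ht]
  exact integral_nonneg fun z => mul_nonneg (jointZ_nonneg F.prob F.trans ht z)
    (Finset.sum_nonneg fun i _ => sq_nonneg _)

/-! ### The derivatives of the mutual information -/

lemma hasDerivAt_mutualInfo (F : IsRapidFlow V μ₀ p) (ht : 0 < t) :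
    HasDerivAt (fun s => mutualInfo μ₀ (p s)) (-mutualRelFisher V μ₀ (p t)) t := by
  have SJ := logFPSystem_joint (b := 2 * t) F.smooth_potential F.prob F.trans F.decay (half_pos ht)
  have SM := logFPSystem_marginal (b := 2 * t) F.smooth_potential F.prob F.trans F.decay
    (half_pos ht)
  have h := (SJ.hasDerivAt_relEntropy (mem_window ht)).fun_sub
    (SM.hasDerivAt_relEntropy (mem_window ht))
  refine (h.congr_of_eventuallyEq ?_).congr_deriv ?_
  · filter_upwards [Ioi_mem_nhds ht] with s hs using F.mutualInfo_eq hs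
  · rw [F.mutualRelFisher_eq ht]
    ring

lemma hasDerivAt_deriv_mutualInfo (F : IsRapidFlow V μ₀ p) (ht : 0 < t) :
    HasDerivAt (deriv fun s => mutualInfo μ₀ (p s))
      ((∫ z, jointZ μ₀ p t z * (2 * ∑ i, ∑ j,
        ((pd (eX j) (pd (eX i) (logDens p)) (t, z) + partialD j (partialD i V) z.2) ^ 2 +
          (pd (eX i) (logDens p) (t, z) + partialD i V z.2) * partialD j (partialD i V) z.2 *
            (pd (eX j) (logDens p) (t, z) + partialD j V z.2)))) -
      ∫ x, avg μ₀ (dens p) t x * (2 * ∑ i, ∑ j,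
        ((score₂ μ₀ p i j t x + partialD j (partialD i V) x) ^ 2 +
          (score μ₀ p i t x + partialD i V x) * partialD j (partialD i V) x *
            (score μ₀ p j t x + partialD j V x)))) t := by
  have SJ := logFPSystem_joint (b := 2 * t) F.smooth_potential F.prob F.trans F.decay (half_pos ht)
  have SM := logFPSystem_marginal (b := 2 * t) F.smooth_potential F.prob F.trans F.decay
    (half_pos ht)
  have h := (SM.hasDerivAt_relFisher (mem_window ht)).fun_sub
    (SJ.hasDerivAt_relFisher (mem_window ht))
  refine (h.congr_of_eventuallyEq ?_).congr_deriv (by ring)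
  -- The first derivative is identified at every positive time, since differentiating `deriv` needs
  -- it on a neighbourhood of `t`.
  filter_upwards [Ioi_mem_nhds ht] with s hs
  rw [(F.hasDerivAt_mutualInfo hs).deriv, F.mutualRelFisher_eq hs, neg_sub]

lemma moments_backwardFisherTwo (F : IsRapidFlow V μ₀ p) (ht : 0 < t) :
    FiniteMoments volume (jointZ μ₀ p t) (fun z => ∑ i, ∑ j, post₂ μ₀ p t i j z ^ 2) :=
  .sum (F.moments_logDens ht).weight fun i => .sum (F.moments_logDens ht).weight fun j =>
    (F.moments_post₂ ht i j).pow_two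

lemma moments_crossHess (F : IsRapidFlow V μ₀ p) (ht : 0 < t) :
    FiniteMoments volume (jointZ μ₀ p t) (fun z => ∑ i, ∑ j, post₂ μ₀ p t i j z *
      (2⁻¹ * partialD j (partialD i V) z.2 + score₂ μ₀ p i j t z.2)) :=
  .sum (F.moments_logDens ht).weight fun i => .sum (F.moments_logDens ht).weight fun j =>
    (F.moments_post₂ ht i j).mul (F.finiteMoments_snd ht (F.moments_hessLogGamma ht i j))

lemma moments_quadForm (F : IsRapidFlow V μ₀ p) (ht : 0 < t) :
    FiniteMoments volume (jointZ μ₀ p t) (fun z => ∑ i, ∑ j, post μ₀ p t i z * post μ₀ p t j z *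
      (2⁻¹ * partialD j (partialD i V) z.2 + score₂ μ₀ p i j t z.2)) :=
  .sum (F.moments_logDens ht).weight fun i => .sum (F.moments_logDens ht).weight fun j =>
    ((F.moments_post ht i).mul (F.moments_post ht j)).mul
      (F.finiteMoments_snd ht (F.moments_hessLogGamma ht i j))

/-- The posterior means of `∇² log μ_{0|t}` and of `-∇ log μ_{0|t} ∇ log μ_{0|t}ᵀ` agree. -/
lemma integral_post₂_add_eq_zero (F : IsRapidFlow V μ₀ p) (ht : 0 < t)
    {h : Fin N → Fin N → E N → ℝ}
    (hh : ∀ i j, FiniteMoments volume (avg μ₀ (dens p) t) (h i j)) :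
    FiniteMoments volume (jointZ μ₀ p t) (fun z => ∑ i, ∑ j,
      (post₂ μ₀ p t i j z + post μ₀ p t i z * post μ₀ p t j z) * h i j z.2) ∧
    ∫ z, jointZ μ₀ p t z * ∑ i, ∑ j,
      (post₂ μ₀ p t i j z + post μ₀ p t i z * post μ₀ p t j z) * h i j z.2 = 0 := by
  have hw := (F.moments_logDens ht).weight
  have hm := fun i j => (F.moments_post₂ ht i j).add
    ((F.moments_post ht i).mul (F.moments_post ht j))
  have hmm := fun i j => (hm i j).mul (F.finiteMoments_snd ht (hh i j))
  have hs := fun i => FiniteMoments.sum hw (hmm i)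
  refine ⟨.sum hw hs, ?_⟩
  rw [FiniteMoments.integral_sum hs]
  refine Finset.sum_eq_zero fun i _ => ?_
  rw [FiniteMoments.integral_sum (hmm i)]
  exact Finset.sum_eq_zero fun j _ => F.integral_joint_mul_snd_eq_zero ht (hm i j)
    (F.integral_joint_mul_post₂ ht i j) (hh i j)

lemma integral_post_mul_eq_zero (F : IsRapidFlow V μ₀ p) (ht : 0 < t) {h : Fin N → E N → ℝ}
    (hh : ∀ i, FiniteMoments volume (avg μ₀ (dens p) t) (h i)) :
    FiniteMoments volume (jointZ μ₀ p t) (fun z => ∑ i, post μ₀ p t i z * h i z.2) ∧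
    ∫ z, jointZ μ₀ p t z * ∑ i, post μ₀ p t i z * h i z.2 = 0 := by
  have hmm := fun i => (F.moments_post ht i).mul (F.finiteMoments_snd ht (hh i))
  refine ⟨.sum (F.moments_logDens ht).weight hmm, ?_⟩
  rw [FiniteMoments.integral_sum hmm]
  exact Finset.sum_eq_zero fun i _ => F.integral_joint_mul_snd_eq_zero ht (F.moments_post ht i)
    (F.integral_joint_mul_post ht i) (hh i)

/-- The sum of the two integrands is `⟨R + r rᵀ, ∇² log γₜ⟩` against the joint density, and `R + r
rᵀ` is orthogonal to functions of the end point. -/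
lemma integral_crossHess_eq_neg (F : IsRapidFlow V μ₀ p) (ht : 0 < t) :
    ∫ z, crossHessIntegrand V μ₀ (p t) z = -∫ z, quadFormIntegrand V μ₀ (p t) z := by
  rw [F.crossHessIntegrand_eq ht, F.quadFormIntegrand_eq ht, eq_neg_iff_add_eq_zero,
    ← (F.moments_crossHess ht).integral_add (F.moments_quadForm ht)]
  simpa only [← Finset.sum_add_distrib, ← add_mul] using
    (F.integral_post₂_add_eq_zero ht (F.moments_hessLogGamma ht)).2

/-- The marginal integral is rewritten against the joint density, so that the two dissipations can
be subtracted pointwise and the unwanted terms removed by conditioning on the end point. -/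
lemma integral_dissipation_eq (F : IsRapidFlow V μ₀ p) (ht : 0 < t) :
    ((∫ z, jointZ μ₀ p t z * (2 * ∑ i, ∑ j,
        ((pd (eX j) (pd (eX i) (logDens p)) (t, z) + partialD j (partialD i V) z.2) ^ 2 +
          (pd (eX i) (logDens p) (t, z) + partialD i V z.2) * partialD j (partialD i V) z.2 *
            (pd (eX j) (logDens p) (t, z) + partialD j V z.2)))) -
      ∫ x, avg μ₀ (dens p) t x * (2 * ∑ i, ∑ j,
        ((score₂ μ₀ p i j t x + partialD j (partialD i V) x) ^ 2 +
          (score μ₀ p i t x + partialD i V x) * partialD j (partialD i V) x *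
            (score μ₀ p j t x + partialD j V x)))) =
      2 * backwardFisherTwo μ₀ (p t) + 4 * ∫ z, crossHessIntegrand V μ₀ (p t) z := by
  have hw := (F.moments_logDens ht).weight
  have hw' := (F.moments_potential ht).weight
  have hVJ := fun i => F.finiteMoments_snd ht (F.moments_partialD ht i)
  have hV2 := F.moments_partialD_partialD ht
  have hV2J := fun i j => F.finiteMoments_snd ht (hV2 i j)
  have hψ := fun i => (F.moments_score ht i).add (F.moments_partialD ht i)
  have hφ := fun i => (F.moments_dx_logDens ht i).add (hVJ i)
  have hJ : FiniteMoments volume (jointZ μ₀ p t) (fun z => 2 * ∑ i, ∑ j,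
        ((pd (eX j) (pd (eX i) (logDens p)) (t, z) + partialD j (partialD i V) z.2) ^ 2 +
          (pd (eX i) (logDens p) (t, z) + partialD i V z.2) * partialD j (partialD i V) z.2 *
            (pd (eX j) (logDens p) (t, z) + partialD j V z.2))) :=
    (FiniteMoments.sum hw fun i => .sum hw fun j =>
      (((F.moments_dx_dx_logDens ht i j).add (hV2J i j)).pow_two).add
        (((hφ i).mul (hV2J i j)).mul (hφ j))).const_mul 2
  have hM : FiniteMoments volume (avg μ₀ (dens p) t) (fun x => 2 * ∑ i, ∑ j,
        ((score₂ μ₀ p i j t x + partialD j (partialD i V) x) ^ 2 +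
          (score μ₀ p i t x + partialD i V x) * partialD j (partialD i V) x *
            (score μ₀ p j t x + partialD j V x))) :=
    (FiniteMoments.sum hw' fun i => .sum hw' fun j =>
      (((F.moments_score₂ ht i j).add (hV2 i j)).pow_two).add
        (((hψ i).mul (hV2 i j)).mul (hψ j))).const_mul 2
  obtain ⟨m2, z2⟩ := F.integral_post₂_add_eq_zero ht hV2
  obtain ⟨m1, z1⟩ := F.integral_post_mul_eq_zero ht
    (h := fun i x => ∑ j, (partialD j (partialD i V) x + partialD i (partialD j V) x) *
      (score μ₀ p j t x + partialD j V x))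
    fun i => .sum hw' fun j => ((hV2 i j).add (hV2 j i)).mul (hψ j)
  have hB := F.moments_backwardFisherTwo ht
  have hC := (F.moments_crossHess ht).const_mul 2
  -- The two terms of posterior mean zero are inserted, so that the integrand becomes the right side
  -- of `dissipation_difference_identity`.
  have hzero : (∫ z, jointZ μ₀ p t z * ∑ i, ∑ j, post₂ μ₀ p t i j z ^ 2) +
      2 * ∫ z, jointZ μ₀ p t z * (∑ i, ∑ j, post₂ μ₀ p t i j z *
        (2⁻¹ * partialD j (partialD i V) z.2 + score₂ μ₀ p i j t z.2)) =
      ∫ z, jointZ μ₀ p t z * ((∑ i, ∑ j, post₂ μ₀ p t i j z ^ 2) +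
        2 * (∑ i, ∑ j, post₂ μ₀ p t i j z *
          (2⁻¹ * partialD j (partialD i V) z.2 + score₂ μ₀ p i j t z.2)) +
        (∑ i, ∑ j, (post₂ μ₀ p t i j z + post μ₀ p t i z * post μ₀ p t j z) *
          partialD j (partialD i V) z.2) +
        ∑ i, post μ₀ p t i z * ∑ j, (partialD j (partialD i V) z.2 +
          partialD i (partialD j V) z.2) * (score μ₀ p j t z.2 + partialD j V z.2)) := by
    rw [((hB.add hC).add m2).integral_add m1, (hB.add hC).integral_add m2, hB.integral_add hC,
      z1, z2]
    simp only [mul_left_comm _ (2 : ℝ), integral_const_mul, add_zero]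
  rw [← F.integral_joint_snd ht hM, ← hJ.integral_sub (F.finiteMoments_snd ht hM),
    backwardFisherTwo, F.backwardFisherTwoIntegrand_eq ht, F.crossHessIntegrand_eq ht]
  beta_reduce
  have h4 : ∀ A B : ℝ, 2 * A + 4 * B = 2 * (A + 2 * B) := fun A B => by ring
  rw [h4, hzero, ← integral_const_mul]
  refine integral_congr_ae (.of_forall fun z => ?_)
  have key := dissipation_difference_identity (fun i => post μ₀ p t i z)
    (fun i => score μ₀ p i t z.2 + partialD i V z.2) (fun i j => post₂ μ₀ p t i j z)
    (fun i j => score₂ μ₀ p i j t z.2) (fun i j => partialD j (partialD i V) z.2)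
  beta_reduce at key ⊢
  rw [← key, mul_left_comm, mul_sub 2]
  simp only [post, post₂, sub_add_cancel, ← add_assoc]

end IsRapidFlow

end FPFlow

theorem mainTheorem2 {N : ℕ} (V μ₀ : FPFlow.E N → ℝ) (p : ℝ → FPFlow.E N → FPFlow.E N → ℝ)
    (hV : ContDiff ℝ ∞ V) (hμ₀ : FPFlow.IsProbDensity μ₀)
    (hp : FPFlow.IsTransitionDensity V p) (hdecay : FPFlow.RapidlyDecreasing V μ₀ p)
    (t : ℝ) (ht : 0 < t) :
    -- all the integrals below converge absolutely
    (Integrable (FPFlow.entropyIntegrand (FPFlow.marginal μ₀ (p t))) ∧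
      Integrable (fun z : FPFlow.E N × FPFlow.E N =>
        μ₀ z.1 * FPFlow.entropyIntegrand (p t z.1) z.2) ∧
      Integrable (FPFlow.relFisherIntegrand V (FPFlow.marginal μ₀ (p t))) ∧
      Integrable (fun z : FPFlow.E N × FPFlow.E N =>
        μ₀ z.1 * FPFlow.relFisherIntegrand V (p t z.1) z.2) ∧
      Integrable (FPFlow.backwardFisherTwoIntegrand μ₀ (p t)) ∧
      Integrable (FPFlow.crossHessIntegrand V μ₀ (p t)) ∧
      Integrable (FPFlow.quadFormIntegrand V μ₀ (p t))) ∧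
    -- the first derivative
    HasDerivAt (fun s => FPFlow.mutualInfo μ₀ (p s)) (-FPFlow.mutualRelFisher V μ₀ (p t)) t ∧
    -FPFlow.mutualRelFisher V μ₀ (p t) ≤ 0 ∧
    -- the second derivative, in its two forms
    HasDerivAt (deriv fun s => FPFlow.mutualInfo μ₀ (p s))
      (2 * FPFlow.backwardFisherTwo μ₀ (p t) +
        4 * ∫ z, FPFlow.crossHessIntegrand V μ₀ (p t) z) t ∧
    HasDerivAt (deriv fun s => FPFlow.mutualInfo μ₀ (p s))
      (2 * FPFlow.backwardFisherTwo μ₀ (p t) -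
        4 * ∫ z, FPFlow.quadFormIntegrand V μ₀ (p t) z) t := by
  have F : FPFlow.IsRapidFlow V μ₀ p := ⟨hV, hμ₀, hp, hdecay⟩
  have h2 := (F.hasDerivAt_deriv_mutualInfo ht).congr_deriv (F.integral_dissipation_eq ht)
  refine ⟨⟨(F.moments_log_avg ht).integrable, ?_, ?_, ?_, ?_, ?_, ?_⟩, F.hasDerivAt_mutualInfo ht,
    neg_nonpos.2 (F.mutualRelFisher_nonneg ht), h2, ?_⟩
  · refine (F.moments_logDens ht).integrable.congr (.of_forall fun z => ?_)
    exact mul_assoc _ _ _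
  · rw [F.relFisherIntegrand_marginal ht]
    exact (F.moments_relFisher_marginal ht).integrable
  · simp only [F.relFisherIntegrand_trans ht]
    exact (F.moments_relFisher_joint ht).integrable
  · rw [F.backwardFisherTwoIntegrand_eq ht]
    exact (F.moments_backwardFisherTwo ht).integrable
  · rw [F.crossHessIntegrand_eq ht]
    exact (F.moments_crossHess ht).integrable
  · rw [F.quadFormIntegrand_eq ht]
    exact (F.moments_quadForm ht).integrable
  · refine h2.congr_deriv ?_
    rw [F.integral_crossHess_eq_neg ht]
    ring
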